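/- Let $A$ be an $n\times n$ complex matrix. For an eigenvalue $\mu$ of $A$ with algebraic multiplicity $n_\mu$, let $W_\mu=\ker (A-\mu)^{n_\mu}$ be its characteristic space, let $P_\mu$ be the projection onto $W_\mu$ along the direct sum of the other characteristic spaces, and let $N_\mu=(A-\mu)P_\mu$ be the nilpotent part of $A$ at $\mu$ (it equals $A-\mu$ on $W_\mu$ and $0$ on the other characteristic spaces). Let $\Gamma_r\subset\mathbb C$ be a positively oriented rectifiable Jordan curve that does not contain eigenvalues of $A$ and that encloses a region $D_r$ containing exactly one eigenvalue $\lambda_r$ of $A$. Write $n_r,P_r,N_r$ for $n_{\lambda_r},P_{\lambda_r},N_{\lambda_r}$. Let $f$ be analytic on and inside $\Gamma_r$, that is, at every point of $\Gamma_r\cup D_r$. Then the integral below exists and $$\frac{1}{2\pi i}\oint_{\Gamma_r} f(z)\,(z-A)^{-1}\,dz \;=\; f(\lambda_r+N_r)\,P_r \;=\; \sum_{l=0}^{n_r-1}\frac{f^{(l)}(\lambda_r)}{l!}\,N_r^{\,l}P_r \;=\; \sum_{l=0}^{\infty}\frac{f^{(l)}(\lambda_r)}{l!}\,N_r^{\,l}P_r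 .$$ Here, for a square complex matrix $M$, the matrix $f(M)$ is defined by Cauchy's formula $f(M)=\frac{1}{2\pi i}\oint_{\Gamma} f(z)(z-M)^{-1}\,dz$, where $\Gamma$ is any positively oriented rectifiable Jordan curve that encloses the whole spectrum of $M$ and on and inside which $f$ is analytic; part of the claim is that for $M=\lambda_r+N_r$ such a curve exists and that the value does not depend on its choice. -/

import Mathlib

open Set Filter Topology

/-! ### Contour integrals along rectifiable Jordan curves -/

/-- `t 0 ≤ t 1 ≤ ⋯ ≤ t m` is a partition of `[a, b]` of mesh less than `δ`, with a tag `s k` in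
each interval `[t k, t (k + 1)]`. -/
structure IsTaggedPartition (a b δ : ℝ) (m : ℕ) (t s : ℕ → ℝ) : Prop where
  left : t 0 = a
  right : t m = b
  mono : ∀ k < m, t k ≤ t (k + 1)
  mesh : ∀ k < m, t (k + 1) - t k < δ
  tag : ∀ k < m, s k ∈ Icc (t k) (t (k + 1))

/-- The Riemann–Stieltjes sum `∑ F (γ (s k)) (γ (t (k + 1)) - γ (t k))`. -/
def contourSum {E : Type*} [AddCommGroup E] [Module ℂ E] (F : ℂ → E) (γ : ℝ → ℂ)
    (m : ℕ) (t s : ℕ → ℝ) : E :=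
  ∑ k ∈ Finset.range m, (γ (t (k + 1)) - γ (t k)) • F (γ (s k))

/-- `J` is the contour integral `∫ F(z) dz` along the curve `γ : [a, b] → ℂ`, in the sense of
Riemann–Stieltjes: the limit of the Riemann–Stieltjes sums as the mesh tends to `0`. -/
def HasContourIntegral {E : Type*} [AddCommGroup E] [Module ℂ E] [TopologicalSpace E]
    (F : ℂ → E) (γ : ℝ → ℂ) (a b : ℝ) (J : E) : Prop :=
  ∀ V ∈ 𝓝 J, ∃ δ > 0, ∀ (m : ℕ) (t s : ℕ → ℝ),
    IsTaggedPartition a b δ m t s → contourSum F γ m t s ∈ V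

/-- The contour integral of `F` along `γ : [a, b] → ℂ` exists. -/
def ContourIntegrable {E : Type*} [AddCommGroup E] [Module ℂ E] [TopologicalSpace E]
    (F : ℂ → E) (γ : ℝ → ℂ) (a b : ℝ) : Prop :=
  ∃ J, HasContourIntegral F γ a b J

open Classical in
/-- The contour integral of `F` along `γ : [a, b] → ℂ` (and `0` if it does not exist). -/
noncomputable def contourIntegral {E : Type*} [AddCommGroup E] [Module ℂ E] [TopologicalSpace E]
    (F : ℂ → E) (γ : ℝ → ℂ) (a b : ℝ) : E :=
  if h : ContourIntegrable F γ a b then h.choose else 0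

/-- There are tagged partitions of arbitrarily small mesh. -/
theorem exists_isTaggedPartition {a b δ : ℝ} (hab : a ≤ b) (hδ : 0 < δ) :
    ∃ m t s, IsTaggedPartition a b δ m t s := by
  obtain ⟨m, hm⟩ := exists_nat_gt ((b - a) / δ)
  have hm0 : (0 : ℝ) < m := lt_of_le_of_lt (div_nonneg (sub_nonneg.2 hab) hδ.le) hm
  have hstep : 0 ≤ (b - a) / m := div_nonneg (sub_nonneg.2 hab) hm0.le
  refine ⟨m, fun k => a + k * ((b - a) / m), fun k => a + k * ((b - a) / m), ?_, ?_, ?_, ?_, ?_⟩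
  · simp
  · field_simp
    ring
  · intro k _
    push_cast
    linarith
  · intro k _
    push_cast
    have : (b - a) / m < δ := by
      rw [div_lt_iff₀ hm0]
      rw [div_lt_iff₀ hδ] at hm
      linarith
    linarith
  · intro k _
    refine ⟨le_rfl, ?_⟩
    push_cast
    linarith

/-- The contour integral is unique, so that `contourIntegral` does not depend on a choice. -/
theorem HasContourIntegral.contourIntegral_eq {E : Type*} [AddCommGroup E] [Module ℂ E]
    [TopologicalSpace E] [T2Space E] {F : ℂ → E} {γ : ℝ → ℂ} {a b : ℝ} {J : E} (hab : a ≤ b)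
    (h : HasContourIntegral F γ a b J) : contourIntegral F γ a b = J := by
  have hex : ContourIntegrable F γ a b := ⟨J, h⟩
  rw [contourIntegral, dif_pos hex]
  by_contra hne
  obtain ⟨U, V, hU, hV, hxU, hxV, hd⟩ := t2_separation hne
  obtain ⟨δ₁, h₁, H₁⟩ := hex.choose_spec U (hU.mem_nhds hxU)
  obtain ⟨δ₂, h₂, H₂⟩ := h V (hV.mem_nhds hxV)
  obtain ⟨m, t, s, hp⟩ := exists_isTaggedPartition hab (lt_min h₁ h₂)
  refine disjoint_left.1 hd (H₁ m t s ?_) (H₂ m t s ?_)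
  · exact ⟨hp.left, hp.right, hp.mono, fun k hk => (hp.mesh k hk).trans_le (min_le_left _ _),
      hp.tag⟩
  · exact ⟨hp.left, hp.right, hp.mono, fun k hk => (hp.mesh k hk).trans_le (min_le_right _ _),
      hp.tag⟩

/-- `γ : [a, b] → ℂ` is a rectifiable Jordan curve: continuous, closed, without
self-intersections, and of finite length. -/
structure IsRectifiableJordanCurve (γ : ℝ → ℂ) (a b : ℝ) : Prop where
  lt : a < b
  continuousOn : ContinuousOn γ (Icc a b)
  closed : γ a = γ b
  injOn : InjOn γ (Ico a b)
  rectifiable : BoundedVariationOn γ (Icc a b)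

/-- The region enclosed by the curve `γ : [a, b] → ℂ`: the union of the bounded connected
components of the complement of the curve. -/
def enclosedRegion (γ : ℝ → ℂ) (a b : ℝ) : Set ℂ :=
  {z | z ∉ γ '' Icc a b ∧ Bornology.IsBounded (connectedComponentIn (γ '' Icc a b)ᶜ z)}

/-- The closed curve `γ : [a, b] → ℂ` has winding number `k` about `w`: along the curve, a
continuous choice of the argument of `γ - w` increases by `2πk`. -/
def HasWindingNumber (γ : ℝ → ℂ) (a b : ℝ) (w : ℂ) (k : ℤ) : Prop :=
  ∃ θ : ℝ → ℝ, ContinuousOn θ (Icc a b) ∧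
    (∀ τ ∈ Icc a b, γ τ - w = (‖γ τ - w‖ : ℂ) * Complex.exp ((θ τ : ℂ) * Complex.I)) ∧
    θ b - θ a = 2 * Real.pi * k

/-- A closed curve is positively oriented if it winds exactly once, counterclockwise, around
each point that it encloses. -/
def IsPositivelyOriented (γ : ℝ → ℂ) (a b : ℝ) : Prop :=
  ∀ w ∈ enclosedRegion γ a b, HasWindingNumber γ a b w 1

/-! ### Characteristic spaces, projections and nilpotent parts of a complex matrix -/

/-- The characteristic space `W_μ = ker (A - μ)^{n_μ}`, where `n_μ` is the algebraic multiplicity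
of `μ` (so that `W_μ = 0` if `μ` is not an eigenvalue). -/
noncomputable def characteristicSpace {n : ℕ} (A : Matrix (Fin n) (Fin n) ℂ) (μ : ℂ) :
    Submodule ℂ (Fin n → ℂ) :=
  LinearMap.ker (Matrix.toLin' ((A - μ • 1) ^ A.charpoly.rootMultiplicity μ))

theorem genEigenspace_rootMultiplicity_eq {n : ℕ} (g : Module.End ℂ (Fin n → ℂ)) (μ : ℂ) :
    g.genEigenspace μ (g.charpoly.rootMultiplicity μ : ℕ) = g.maxGenEigenspace μ := by
  apply le_antisymm
  · exact (g.genEigenspace μ).mono le_top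
  · rw [← LinearMap.finrank_maxGenEigenspace_eq g μ]
    have hpow : ∀ (k : ℕ) (y : g.maxGenEigenspace μ),
        ((((g - algebraMap ℂ _ μ).restrict (g.mapsTo_maxGenEigenspace_of_comm
          (Algebra.mul_sub_algebraMap_commutes g μ) μ)) ^ k) y : Fin n → ℂ) =
          ((g - algebraMap ℂ _ μ) ^ k) (y : Fin n → ℂ) := by
      intro k
      induction k with
      | zero => intro y; rfl
      | succ k ih => intro y; rw [pow_succ, pow_succ, Module.End.mul_apply, ih]; rfl
    have hch := (g.isNilpotent_restrict_maxGenEigenspace_sub_algebraMap μ).charpoly_eq_X_pow_finrank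
    have hz := LinearMap.aeval_self_charpoly ((g - algebraMap ℂ _ μ).restrict
      (g.mapsTo_maxGenEigenspace_of_comm (Algebra.mul_sub_algebraMap_commutes g μ) μ))
    rw [hch, map_pow, Polynomial.aeval_X] at hz
    intro x hx
    rw [Module.End.mem_genEigenspace_nat, LinearMap.mem_ker]
    have := congrArg Subtype.val (LinearMap.congr_fun hz ⟨x, hx⟩)
    rw [hpow] at this
    simpa [Algebra.algebraMap_eq_smul_one] using this

theorem characteristicSpace_eq_maxGenEigenspace {n : ℕ} (A : Matrix (Fin n) (Fin n) ℂ) (μ : ℂ) :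
    characteristicSpace A μ = Module.End.maxGenEigenspace (Matrix.toLin' A) μ := by
  rw [← genEigenspace_rootMultiplicity_eq, Matrix.charpoly_toLin', characteristicSpace,
    Module.End.genEigenspace_nat, Matrix.toLin'_pow]
  simp [Module.End.one_eq_id]

/-- `ℂⁿ` is the direct sum of `W_μ` and the other characteristic spaces. -/
theorem isCompl_characteristicSpace {n : ℕ} (A : Matrix (Fin n) (Fin n) ℂ) (μ : ℂ) :
    IsCompl (characteristicSpace A μ) (⨆ (ν : ℂ) (_ : ν ≠ μ), characteristicSpace A ν) := by
  simp only [characteristicSpace_eq_maxGenEigenspace]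
  refine ⟨Module.End.independent_maxGenEigenspace (Matrix.toLin' A) μ, codisjoint_iff.2 ?_⟩
  rw [eq_top_iff, ← Module.End.iSup_maxGenEigenspace_eq_top (Matrix.toLin' A)]
  refine iSup_le fun ν => ?_
  by_cases h : ν = μ
  · subst h
    exact le_sup_left
  · exact le_sup_of_le_right (le_iSup₂_of_le ν h le_rfl)

/-- The projection `P_μ` onto the characteristic space `W_μ` along the direct sum of the other
characteristic spaces, as a matrix. -/
noncomputable def characteristicProjection {n : ℕ} (A : Matrix (Fin n) (Fin n) ℂ) (μ : ℂ) :
    Matrix (Fin n) (Fin n) ℂ :=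
  LinearMap.toMatrix' (Submodule.projection (characteristicSpace A μ)
    (⨆ (ν : ℂ) (_ : ν ≠ μ), characteristicSpace A ν) (isCompl_characteristicSpace A μ))

/-- The nilpotent part `N_μ` of `A` at `μ`: it is `A - μ` on `W_μ` and `0` on the other
characteristic spaces. In a Jordan basis these are the off-diagonal entries of the Jordan blocks
of `μ`. -/
noncomputable def nilpotentPart {n : ℕ} (A : Matrix (Fin n) (Fin n) ℂ) (μ : ℂ) :
    Matrix (Fin n) (Fin n) ℂ :=
  (A - μ • 1) * characteristicProjection A μ

/-! ### Functions of a matrix by Cauchy's formula -/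

/-- The integrand `f(z) (z - M)⁻¹`. -/
noncomputable def cauchyIntegrand {n : ℕ} (f : ℂ → ℂ) (M : Matrix (Fin n) (Fin n) ℂ) (z : ℂ) :
    Matrix (Fin n) (Fin n) ℂ :=
  f z • (z • (1 : Matrix (Fin n) (Fin n) ℂ) - M)⁻¹

/-- `γ` is a positively oriented rectifiable Jordan curve that encloses the whole spectrum of `M`,
and `f` is analytic on and inside `γ`. -/
structure IsCauchyContour {n : ℕ} (f : ℂ → ℂ) (M : Matrix (Fin n) (Fin n) ℂ)
    (γ : ℝ → ℂ) (a b : ℝ) : Prop where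
  jordan : IsRectifiableJordanCurve γ a b
  oriented : IsPositivelyOriented γ a b
  analytic : AnalyticOnNhd ℂ f (γ '' Icc a b ∪ enclosedRegion γ a b)
  spectrum_subset : spectrum ℂ M ⊆ enclosedRegion γ a b

/-- `X = f(M)` in the sense of Cauchy's formula `f(M) = (1/2πi) ∮ f(z) (z - M)⁻¹ dz`: there is a
contour as in that formula, and every such contour yields the value `X`. -/
def IsMatrixFunctionValue {n : ℕ} (f : ℂ → ℂ) (M X : Matrix (Fin n) (Fin n) ℂ) : Prop :=
  (∃ (γ : ℝ → ℂ) (a b : ℝ), IsCauchyContour f M γ a b) ∧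
    ∀ (γ : ℝ → ℂ) (a b : ℝ), IsCauchyContour f M γ a b →
      ContourIntegrable (cauchyIntegrand f M) γ a b ∧
      (2 * (Real.pi : ℂ) * Complex.I)⁻¹ • contourIntegral (cauchyIntegrand f M) γ a b = X

/-! Write `P` for the projection onto the characteristic space of λ and split the resolvent along `1
= P + (1 - P)`. On the range of `P`, `A` acts as λ + N with N nilpotent, so the resolvent there is
the finite Neumann series `∑ (z - λ)⁻¹ ^ (l + 1) • N ^ l * P`
(`Matrix.inv_mul_characteristicProjection`), and Cauchy's formula for Taylor coefficients integrates
it term by term. On the range of `1 - P` the resolvent extends holomorphically across λ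
(`Matrix.inv_mul_one_sub_characteristicProjection`), so Cauchy's theorem makes that contribution
vanish. The same Neumann series for λ + N itself, whose only eigenvalue is λ, gives one and the same
polynomial in N for every admissible contour.

The analytic burden is Cauchy theory on merely rectifiable curves. Integrals of continuous functions
exist because a continuous path of bounded variation is, in each coordinate, a difference of
Stieltjes functions. Cauchy's theorem comes from Dixon's argument
(`contourIntegral_dslope_eq_zero`): the integral of the difference quotient of `g`, continued
outside by the Cauchy integral of `g`, is entire and tends to 0 at infinity, hence is zero by
Liouville. The two expressions agree outside the curve because the winding number vanishes there.
Orientation enters through the winding number 1 about λ. -/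

namespace IsTaggedPartition

variable {a b δ : ℝ} {m : ℕ} {t s : ℕ → ℝ}

theorem monotoneOn (h : IsTaggedPartition a b δ m t s) : MonotoneOn t (Icc 0 m) := by
  refine monotoneOn_of_le_succ ordConnected_Icc fun k _ _ hk => ?_
  exact h.mono k (Nat.lt_of_succ_le hk.2)

theorem mem_Icc (h : IsTaggedPartition a b δ m t s) {k : ℕ} (hk : k ≤ m) : t k ∈ Icc a b := by
  refine ⟨?_, ?_⟩
  · rw [← h.left]
    exact h.monotoneOn ⟨le_rfl, Nat.zero_le _⟩ ⟨Nat.zero_le _, hk⟩ (Nat.zero_le _)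
  · rw [← h.right]
    exact h.monotoneOn ⟨Nat.zero_le _, hk⟩ ⟨Nat.zero_le _, le_rfl⟩ hk

theorem tag_mem_Icc (h : IsTaggedPartition a b δ m t s) {k : ℕ} (hk : k < m) : s k ∈ Icc a b :=
  ⟨(h.mem_Icc hk.le).1.trans (h.tag k hk).1, (h.tag k hk).2.trans (h.mem_Icc hk).2⟩

theorem mesh_mono {δ' : ℝ} (h : IsTaggedPartition a b δ m t s) (hδ : δ ≤ δ') :
    IsTaggedPartition a b δ' m t s :=
  ⟨h.left, h.right, h.mono, fun k hk => (h.mesh k hk).trans_le hδ, h.tag⟩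

theorem abs_sub_tag_lt (h : IsTaggedPartition a b δ m t s) {k : ℕ} (hk : k < m) {x : ℝ}
    (hx : x ∈ Icc (t k) (t (k + 1))) : |x - s k| < δ := by
  have h1 := h.mesh k hk
  have h2 := h.tag k hk
  rw [abs_lt]
  constructor <;> linarith [hx.1, hx.2, h2.1, h2.2]

end IsTaggedPartition

/-! ### Existence of Riemann–Stieltjes integrals. -/

/-- The increment of `p` over a subinterval is the measure of the half-open interval, so the sum
integrates a step function that is within `ε` of `φ`; the total mass is `p b - p a`. -/
theorem StieltjesFunction.norm_integral_sub_sum_le (p : StieltjesFunction ℝ) {a b δ ε : ℝ}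
    {φ : ℝ → ℂ} (hφ : ContinuousOn φ (Icc a b))
    (hε : ∀ x ∈ Icc a b, ∀ y ∈ Icc a b, |x - y| < δ → ‖φ x - φ y‖ ≤ ε)
    {m : ℕ} {t s : ℕ → ℝ} (h : IsTaggedPartition a b δ m t s) :
    ‖(∫ x in a..b, φ x ∂p.measure) -
      ∑ k ∈ Finset.range m, ((p (t (k + 1)) - p (t k) : ℝ) : ℂ) * φ (s k)‖ ≤
      ε * (p b - p a) := by
  have hsub : ∀ k < m, Icc (t k) (t (k + 1)) ⊆ Icc a b := fun k hk =>
    Icc_subset_Icc (h.mem_Icc hk.le).1 (h.mem_Icc hk).2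
  have hint : ∀ k < m, IntervalIntegrable φ p.measure (t k) (t (k + 1)) := fun k hk => by
    refine ContinuousOn.intervalIntegrable ?_
    rw [uIcc_of_le (h.mono k hk)]
    exact hφ.mono (hsub k hk)
  have hsplit := intervalIntegral.sum_integral_adjacent_intervals (μ := p.measure) hint
  rw [h.left, h.right] at hsplit
  have htel : ∑ k ∈ Finset.range m, (p (t (k + 1)) - p (t k)) = p b - p a := by
    rw [Finset.sum_range_sub (fun k => p (t k)), h.left, h.right]
  rw [← hsplit, ← Finset.sum_sub_distrib, ← htel, Finset.mul_sum]
  refine norm_sum_le_of_le _ fun k hk => ?_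
  rw [Finset.mem_range] at hk
  have hp : 0 ≤ p (t (k + 1)) - p (t k) := sub_nonneg.2 (p.mono (h.mono k hk))
  have hreal : p.measure.real (Ioc (t k) (t (k + 1))) = p (t (k + 1)) - p (t k) := by
    rw [MeasureTheory.measureReal_def, p.measure_Ioc, ENNReal.toReal_ofReal hp]
  have hconst : ((p (t (k + 1)) - p (t k) : ℝ) : ℂ) * φ (s k) =
      ∫ _ in t k..t (k + 1), φ (s k) ∂p.measure := by
    rw [intervalIntegral.integral_of_le (h.mono k hk), MeasureTheory.setIntegral_const, hreal]
    simp
  rw [hconst, ← intervalIntegral.integral_sub (hint k hk) (by simp),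
    intervalIntegral.integral_of_le (h.mono k hk), ← hreal]
  refine MeasureTheory.norm_setIntegral_le_of_norm_le_const (by simp [p.measure_Ioc]) fun x hx => ?_
  exact hε x (hsub k hk ⟨hx.1.le, hx.2⟩) _ (h.tag_mem_Icc hk) (h.abs_sub_tag_lt hk ⟨hx.1.le, hx.2⟩)

/-- A continuous function of bounded variation is a difference of two Stieltjes functions. -/
theorem BoundedVariationOn.exists_stieltjesFunction_sub {g : ℝ → ℝ} (hc : Continuous g)
    (hg : BoundedVariationOn g univ) :
    ∃ p q : StieltjesFunction ℝ, ∀ x, g x = p x - q x := by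
  have hp := variationOnFromTo.monotoneOn hg.locallyBoundedVariationOn (mem_univ (0 : ℝ))
  have hq := variationOnFromTo.sub_self_monotoneOn hg.locallyBoundedVariationOn (mem_univ (0 : ℝ))
  have hr : ∀ x, ContinuousWithinAt (variationOnFromTo g univ 0) (Ici x) x := fun x =>
    hg.continuousWithinAt_variationOnFromTo_Ici (hc.continuousWithinAt)
  -- Jordan decomposition `g = v - (v - g)` with `v` the variation function; continuity of `g`
  -- supplies the right-continuity that Stieltjes functions require.
  refine ⟨⟨variationOnFromTo g univ 0, monotoneOn_univ.1 hp, hr⟩,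
    ⟨variationOnFromTo g univ 0 - g, monotoneOn_univ.1 hq, fun x => ?_⟩, fun x => ?_⟩
  · exact (hr x).sub hc.continuousWithinAt
  · change g x = variationOnFromTo g univ 0 x - (variationOnFromTo g univ 0 x - g x)
    ring

/-- Real case of the existence of Riemann–Stieltjes integrals. -/
theorem exists_stieltjes_integral_real {γ : ℝ → ℝ} {a b : ℝ} (hab : a ≤ b)
    (hc : ContinuousOn γ (Icc a b)) (hbv : BoundedVariationOn γ (Icc a b)) :
    ∃ (J : (ℝ → ℂ) → ℂ) (V : ℝ), 0 ≤ V ∧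
      ∀ φ : ℝ → ℂ, ContinuousOn φ (Icc a b) → ∀ ε δ : ℝ,
        (∀ x ∈ Icc a b, ∀ y ∈ Icc a b, |x - y| < δ → ‖φ x - φ y‖ ≤ ε) →
        ∀ (m : ℕ) (t s : ℕ → ℝ), IsTaggedPartition a b δ m t s →
          ‖J φ - ∑ k ∈ Finset.range m, ((γ (t (k + 1)) - γ (t k) : ℝ) : ℂ) * φ (s k)‖ ≤ ε * V := by
  -- Precomposing with the projection onto `[a, b]` extends the path constantly to the whole line
  -- without increasing its variation.
  have hc' : Continuous (γ ∘ fun x => (projIcc a b hab x : ℝ)) :=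
    hc.comp_continuous (continuous_subtype_val.comp continuous_projIcc) fun x => (projIcc a b hab x).2
  have hbv' : BoundedVariationOn (γ ∘ fun x => (projIcc a b hab x : ℝ)) univ :=
    ne_top_of_le_ne_top hbv (eVariationOn.comp_le_of_monotoneOn γ _
      (fun x _ y _ hxy => monotone_projIcc hab hxy) fun x _ => (projIcc a b hab x).2)
  obtain ⟨p, q, hpq⟩ := hbv'.exists_stieltjesFunction_sub hc'
  have hγ : ∀ x ∈ Icc a b, γ x = p x - q x := fun x hx => by
    rw [← hpq x, Function.comp_apply, projIcc_of_mem hab hx]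
  refine ⟨fun φ => (∫ x in a..b, φ x ∂p.measure) - ∫ x in a..b, φ x ∂q.measure,
    (p b - p a) + (q b - q a),
    add_nonneg (sub_nonneg.2 (p.mono hab)) (sub_nonneg.2 (q.mono hab)), ?_⟩
  intro φ hφ ε δ hε m t s h
  have hsum : ∑ k ∈ Finset.range m, ((γ (t (k + 1)) - γ (t k) : ℝ) : ℂ) * φ (s k) =
      ∑ k ∈ Finset.range m, ((p (t (k + 1)) - p (t k) : ℝ) : ℂ) * φ (s k) -
      ∑ k ∈ Finset.range m, ((q (t (k + 1)) - q (t k) : ℝ) : ℂ) * φ (s k) := by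
    rw [← Finset.sum_sub_distrib]
    refine Finset.sum_congr rfl fun k hk => ?_
    rw [Finset.mem_range] at hk
    rw [hγ _ (h.mem_Icc hk), hγ _ (h.mem_Icc hk.le)]
    push_cast
    ring
  rw [hsum, sub_sub_sub_comm, mul_add]
  exact (norm_sub_le _ _).trans (add_le_add (p.norm_integral_sub_sum_le hφ hε h)
    (q.norm_integral_sub_sum_le hφ hε h))

/-- Riemann–Stieltjes integrals along a rectifiable path exist, and the error of a Riemann–Stieltjes
sum is controlled by the modulus of continuity of the integrand. -/
theorem exists_stieltjes_integral {γ : ℝ → ℂ} {a b : ℝ} (hab : a ≤ b)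
    (hc : ContinuousOn γ (Icc a b)) (hbv : BoundedVariationOn γ (Icc a b)) :
    ∃ (J : (ℝ → ℂ) → ℂ) (V : ℝ), 0 ≤ V ∧
      ∀ φ : ℝ → ℂ, ContinuousOn φ (Icc a b) → ∀ ε δ : ℝ,
        (∀ x ∈ Icc a b, ∀ y ∈ Icc a b, |x - y| < δ → ‖φ x - φ y‖ ≤ ε) →
        ∀ (m : ℕ) (t s : ℕ → ℝ), IsTaggedPartition a b δ m t s →
          ‖J φ - ∑ k ∈ Finset.range m, (γ (t (k + 1)) - γ (t k)) * φ (s k)‖ ≤ ε * V := by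
  have hre : LipschitzWith 1 Complex.re := by
    simpa using! Complex.reCLM.lipschitz
  have him : LipschitzWith 1 Complex.im := by
    simpa using! Complex.imCLM.lipschitz
  obtain ⟨J₁, V₁, hV₁, h₁⟩ := exists_stieltjes_integral_real hab
    (Complex.continuous_re.comp_continuousOn hc) (hre.comp_boundedVariationOn hbv)
  obtain ⟨J₂, V₂, hV₂, h₂⟩ := exists_stieltjes_integral_real hab
    (Complex.continuous_im.comp_continuousOn hc) (him.comp_boundedVariationOn hbv)
  refine ⟨fun φ => J₁ φ + Complex.I * J₂ φ, V₁ + V₂, add_nonneg hV₁ hV₂, ?_⟩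
  intro φ hφ ε δ hε m t s h
  have hsum : ∑ k ∈ Finset.range m, (γ (t (k + 1)) - γ (t k)) * φ (s k) =
      ∑ k ∈ Finset.range m, (((γ (t (k + 1))).re - (γ (t k)).re : ℝ) : ℂ) * φ (s k) + Complex.I *
      ∑ k ∈ Finset.range m, (((γ (t (k + 1))).im - (γ (t k)).im : ℝ) : ℂ) * φ (s k) := by
    rw [Finset.mul_sum, ← Finset.sum_add_distrib]
    refine Finset.sum_congr rfl fun k _ => ?_
    nth_rewrite 1 [← Complex.re_add_im (γ (t (k + 1))), ← Complex.re_add_im (γ (t k))]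
    push_cast
    ring
  rw [hsum, add_sub_add_comm, ← mul_sub, mul_add]
  refine (norm_add_le _ _).trans (add_le_add (h₁ φ hφ ε δ hε m t s h) ?_)
  rw [norm_mul, Complex.norm_I, one_mul]
  exact h₂ φ hφ ε δ hε m t s h

/-! ### Contour integrals as limits along a filter. -/

/-- The filter of tagged partitions of `[a, b]` of mesh tending to `0`. -/
def taggedPartitions (a b : ℝ) : Filter (ℕ × (ℕ → ℝ) × (ℕ → ℝ)) :=
  ⨅ δ ∈ Ioi (0 : ℝ), 𝓟 {p | IsTaggedPartition a b δ p.1 p.2.1 p.2.2}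

theorem taggedPartitions_hasBasis (a b : ℝ) :
    (taggedPartitions a b).HasBasis (fun δ : ℝ => 0 < δ)
      fun δ => {p | IsTaggedPartition a b δ p.1 p.2.1 p.2.2} := by
  refine hasBasis_biInf_principal (fun δ₁ h₁ δ₂ h₂ => ?_) ⟨1, mem_Ioi.2 one_pos⟩
  exact ⟨min δ₁ δ₂, mem_Ioi.2 (lt_min h₁ h₂), fun p hp => hp.mesh_mono (min_le_left _ _),
    fun p hp => hp.mesh_mono (min_le_right _ _)⟩

theorem taggedPartitions_neBot {a b : ℝ} (hab : a ≤ b) : (taggedPartitions a b).NeBot := by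
  rw [(taggedPartitions_hasBasis a b).neBot_iff]
  intro δ hδ
  obtain ⟨m, t, s, h⟩ := exists_isTaggedPartition hab hδ
  exact ⟨(m, t, s), h⟩

theorem contourSum_congr {E : Type*} [AddCommGroup E] [Module ℂ E] {F G : ℂ → E} {γ : ℝ → ℂ}
    {a b δ : ℝ} {m : ℕ} {t s : ℕ → ℝ} (h : IsTaggedPartition a b δ m t s)
    (hFG : EqOn F G (γ '' Icc a b)) : contourSum F γ m t s = contourSum G γ m t s := by
  refine Finset.sum_congr rfl fun k hk => ?_
  rw [hFG (mem_image_of_mem γ (h.tag_mem_Icc (Finset.mem_range.1 hk)))]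

section General

variable {E : Type*} [AddCommGroup E] [Module ℂ E] [TopologicalSpace E]
  {F G : ℂ → E} {γ : ℝ → ℂ} {a b : ℝ} {I J : E}

/-- Gives access to the limit calculus of filters: linearity, norm bounds and locally uniform
convergence. -/
theorem hasContourIntegral_iff_tendsto :
    HasContourIntegral F γ a b J ↔
      Tendsto (fun p : ℕ × (ℕ → ℝ) × (ℕ → ℝ) => contourSum F γ p.1 p.2.1 p.2.2)
        (taggedPartitions a b) (𝓝 J) := by
  simp only [HasContourIntegral, Tendsto, le_def, mem_map, (taggedPartitions_hasBasis a b).mem_iff]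
  refine forall₂_congr fun V _ => exists_congr fun δ => and_congr_right fun _ => ?_
  exact ⟨fun h p hp => h p.1 p.2.1 p.2.2 hp, fun h m t s hp => @h (m, t, s) hp⟩

namespace HasContourIntegral

theorem congr (h : HasContourIntegral F γ a b J) (hFG : EqOn F G (γ '' Icc a b)) :
    HasContourIntegral G γ a b J := by
  intro V hV
  obtain ⟨δ, hδ, H⟩ := h V hV
  exact ⟨δ, hδ, fun m t s hp => contourSum_congr hp hFG ▸ H m t s hp⟩

theorem add [ContinuousAdd E] (hF : HasContourIntegral F γ a b I)
    (hG : HasContourIntegral G γ a b J) :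
    HasContourIntegral (fun z => F z + G z) γ a b (I + J) := by
  rw [hasContourIntegral_iff_tendsto] at hF hG ⊢
  refine (hF.add hG).congr fun p => ?_
  simp [contourSum, Finset.sum_add_distrib]

theorem sum [ContinuousAdd E] {ι : Type*} (u : Finset ι) {F : ι → ℂ → E} {J : ι → E}
    (h : ∀ i ∈ u, HasContourIntegral (F i) γ a b (J i)) :
    HasContourIntegral (fun z => ∑ i ∈ u, F i z) γ a b (∑ i ∈ u, J i) := by
  simp only [hasContourIntegral_iff_tendsto] at h ⊢
  refine (tendsto_finsetSum u h).congr fun p => ?_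
  simp only [contourSum, Finset.smul_sum]
  exact Finset.sum_comm

theorem const_smul [ContinuousConstSMul ℂ E] (h : HasContourIntegral F γ a b J) (c : ℂ) :
    HasContourIntegral (fun z => c • F z) γ a b (c • J) := by
  rw [hasContourIntegral_iff_tendsto] at h ⊢
  refine (h.const_smul c).congr fun p => ?_
  simp only [contourSum, Finset.smul_sum]
  exact Finset.sum_congr rfl fun k _ => smul_comm _ _ _

theorem smul_const [ContinuousSMul ℂ E] {F : ℂ → ℂ} {J : ℂ} (h : HasContourIntegral F γ a b J)
    (x : E) : HasContourIntegral (fun z => F z • x) γ a b (J • x) := by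
  rw [hasContourIntegral_iff_tendsto] at h ⊢
  refine (h.smul_const x).congr fun p => ?_
  simp [contourSum, Finset.sum_smul, mul_smul]

end HasContourIntegral

end General

theorem IsTaggedPartition.sum_norm_le {γ : ℝ → ℂ} {a b δ : ℝ} {m : ℕ} {t s : ℕ → ℝ}
    (h : IsTaggedPartition a b δ m t s) (hγ : BoundedVariationOn γ (Icc a b)) :
    ∑ k ∈ Finset.range m, ‖γ (t (k + 1)) - γ (t k)‖ ≤ (eVariationOn γ (Icc a b)).toReal := by
  have := eVariationOn.sum_le_of_monotoneOn_Icc (f := γ) (s := Icc a b) h.monotoneOn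
    fun i hi => h.mem_Icc hi.2
  rw [← Finset.range_eq_Ico] at this
  refine le_of_eq_of_le ?_ (ENNReal.toReal_mono hγ this)
  rw [ENNReal.toReal_sum fun k _ => edist_ne_top _ _]
  exact Finset.sum_congr rfl fun k _ => by rw [← dist_edist, dist_eq_norm]

/-! ### Integration along rectifiable curves: primitives, logarithms, dependence on parameters. -/

namespace IsRectifiableJordanCurve

variable {γ : ℝ → ℂ} {a b : ℝ}

theorem isCompact_image (h : IsRectifiableJordanCurve γ a b) : IsCompact (γ '' Icc a b) :=
  isCompact_Icc.image_of_continuousOn h.continuousOn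

theorem norm_le_of_hasContourIntegral (h : IsRectifiableJordanCurve γ a b) {F : ℂ → ℂ} {J : ℂ}
    (hJ : HasContourIntegral F γ a b J) {C : ℝ} (hC : ∀ z ∈ γ '' Icc a b, ‖F z‖ ≤ C) :
    ‖J‖ ≤ C * (eVariationOn γ (Icc a b)).toReal := by
  have := taggedPartitions_neBot h.lt.le
  have hC0 : 0 ≤ C :=
    (norm_nonneg _).trans (hC _ (mem_image_of_mem γ (left_mem_Icc.2 h.lt.le)))
  rw [hasContourIntegral_iff_tendsto] at hJ
  refine le_of_tendsto hJ.norm ?_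
  refine (taggedPartitions_hasBasis a b).eventually_iff.2 ⟨1, one_pos, fun p hp => ?_⟩
  refine le_trans ?_ (mul_le_mul_of_nonneg_left (hp.sum_norm_le h.rectifiable) hC0)
  rw [Finset.mul_sum]
  refine norm_sum_le_of_le _ fun k hk => ?_
  rw [norm_smul, mul_comm]
  exact mul_le_mul_of_nonneg_right
    (hC _ (mem_image_of_mem γ (hp.tag_mem_Icc (Finset.mem_range.1 hk)))) (norm_nonneg _)

/-- The point is that `V` does not depend on `F`: the error estimate is then uniform over families
of integrands with a common modulus of continuity. -/
theorem exists_norm_contourIntegral_sub_le (h : IsRectifiableJordanCurve γ a b) :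
    ∃ V : ℝ, 0 ≤ V ∧ ∀ F : ℂ → ℂ, ContinuousOn F (γ '' Icc a b) →
      HasContourIntegral F γ a b (contourIntegral F γ a b) ∧ ∀ ε δ : ℝ,
        (∀ x ∈ Icc a b, ∀ y ∈ Icc a b, |x - y| < δ → ‖F (γ x) - F (γ y)‖ ≤ ε) →
        ∀ (m : ℕ) (t s : ℕ → ℝ), IsTaggedPartition a b δ m t s →
          ‖contourIntegral F γ a b - contourSum F γ m t s‖ ≤ ε * V := by
  obtain ⟨J, V, hV, H⟩ := exists_stieltjes_integral h.lt.le h.continuousOn h.rectifiable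
  refine ⟨V, hV, fun F hF => ?_⟩
  have hFγ : ContinuousOn (F ∘ γ) (Icc a b) := hF.comp h.continuousOn (mapsTo_image γ _)
  have hJ : HasContourIntegral F γ a b (J (F ∘ γ)) := by
    rw [hasContourIntegral_iff_tendsto, Metric.tendsto_nhds]
    intro ε hε
    obtain ⟨δ, hδ, hu⟩ := Metric.uniformContinuousOn_iff.1
      (isCompact_Icc.uniformContinuousOn_of_continuous hFγ) (ε / (V + 1)) (by positivity)
    refine (taggedPartitions_hasBasis a b).eventually_iff.2 ⟨δ, hδ, fun p hp => ?_⟩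
    rw [dist_comm, dist_eq_norm]
    refine (H _ hFγ (ε / (V + 1)) δ (fun x hx y hy hxy => ?_) _ _ _ hp).trans_lt ?_
    · rw [← dist_eq_norm]
      exact (hu x hx y hy hxy).le
    · rw [div_mul_eq_mul_div, div_lt_iff₀ (by positivity)]
      nlinarith
  rw [hJ.contourIntegral_eq h.lt.le]
  exact ⟨hJ, fun ε δ hε m t s hp => H _ hFγ ε δ hε m t s hp⟩

theorem hasContourIntegral (h : IsRectifiableJordanCurve γ a b) {F : ℂ → ℂ}
    (hF : ContinuousOn F (γ '' Icc a b)) :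
    HasContourIntegral F γ a b (contourIntegral F γ a b) :=
  let ⟨_, _, H⟩ := h.exists_norm_contourIntegral_sub_le
  (H F hF).1

/-- The fundamental theorem of calculus along a rectifiable path: `Φ` is a continuous choice of
local primitives of `F` along `γ`. -/
theorem hasContourIntegral_of_local_primitive (h : IsRectifiableJordanCurve γ a b) {F : ℂ → ℂ}
    (hF : ContinuousOn F (γ '' Icc a b)) {Φ : ℝ → ℂ}
    (hΦ : ∀ τ ∈ Icc a b, ∃ G : ℂ → ℂ, HasStrictDerivAt G (F (γ τ)) (γ τ) ∧
      ∀ᶠ t in 𝓝[Icc a b] τ, Φ t = G (γ t)) :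
    HasContourIntegral F γ a b (Φ b - Φ a) := by
  rw [hasContourIntegral_iff_tendsto, Metric.tendsto_nhds]
  intro ε hε
  set V := (eVariationOn γ (Icc a b)).toReal
  have hV : 0 ≤ V := ENNReal.toReal_nonneg
  -- Two errors of relative size `η` occur: differentiating the local primitive, and moving `F` from
  -- the centre to the tag. The `+ 1` covers `V = 0`.
  set η := ε / (2 * (V + 1)) with hη
  have hη0 : 0 < η := by positivity
  have hloc : ∀ τ : Icc a b, ∃ δ > 0, ∀ x ∈ Icc a b, ∀ y ∈ Icc a b, ∀ z ∈ Icc a b,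
      x ∈ Metric.ball (τ : ℝ) δ → y ∈ Metric.ball (τ : ℝ) δ → z ∈ Metric.ball (τ : ℝ) δ →
      ‖Φ y - Φ x - (γ y - γ x) * F (γ z)‖ ≤ 2 * η * ‖γ y - γ x‖ := by
    rintro ⟨τ, hτ⟩
    obtain ⟨G, hG, hΦG⟩ := hΦ τ hτ
    have hγ : Tendsto γ (𝓝[Icc a b] τ) (𝓝 (γ τ)) := h.continuousOn τ hτ
    -- Strict differentiability lets both endpoints of a chord vary near `τ`.
    have h1 : ∀ᶠ p : ℝ × ℝ in 𝓝[Icc a b] τ ×ˢ 𝓝[Icc a b] τ,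
        ‖G (γ p.1) - G (γ p.2) - (γ p.1 - γ p.2) * F (γ τ)‖ ≤ η * ‖γ p.1 - γ p.2‖ := by
      have := (hG.hasStrictFDerivAt.isLittleO.comp_tendsto
        ((hγ.prodMap hγ).trans (nhds_prod_eq (x := γ τ) (y := γ τ)).ge)).bound hη0
      filter_upwards [this] with p hp
      simpa using hp
    obtain ⟨U, hU, hUG⟩ := eventually_prod_self_iff (r := fun x y =>
      ‖G (γ x) - G (γ y) - (γ x - γ y) * F (γ τ)‖ ≤ η * ‖γ x - γ y‖) |>.1 h1
    have hFγ : ContinuousOn (fun x => F (γ x)) (Icc a b) :=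
      hF.comp h.continuousOn (mapsTo_image γ _)
    have h2 : ∀ᶠ z in 𝓝[Icc a b] τ, ‖F (γ z) - F (γ τ)‖ ≤ η := by
      filter_upwards [Metric.tendsto_nhds.1 (hFγ τ hτ) η hη0] with z hz
      rw [← dist_eq_norm]
      exact hz.le
    obtain ⟨δ, hδ, hδU⟩ := Metric.mem_nhdsWithin_iff.1 (inter_mem hU (inter_mem hΦG h2))
    refine ⟨δ, hδ, fun x hx y hy z hz hxδ hyδ hzδ => ?_⟩
    obtain ⟨hxU, hxG, -⟩ := hδU ⟨hxδ, hx⟩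
    obtain ⟨hyU, hyG, -⟩ := hδU ⟨hyδ, hy⟩
    obtain ⟨-, -, hzF⟩ := hδU ⟨hzδ, hz⟩
    rw [mem_ofPred_eq] at hxG hyG hzF
    rw [hxG, hyG]
    have h3 := hUG y hyU x hxU
    calc ‖G (γ y) - G (γ x) - (γ y - γ x) * F (γ z)‖
        = ‖(G (γ y) - G (γ x) - (γ y - γ x) * F (γ τ)) -
            (γ y - γ x) * (F (γ z) - F (γ τ))‖ := by ring_nf
      _ ≤ η * ‖γ y - γ x‖ + ‖γ y - γ x‖ * η := by
          refine (norm_sub_le _ _).trans (add_le_add h3 ?_)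
          rw [norm_mul]
          exact mul_le_mul_of_nonneg_left hzF (norm_nonneg _)
      _ = 2 * η * ‖γ y - γ x‖ := by ring
  choose r hr0 hr using hloc
  -- A Lebesgue number of the cover puts every subinterval of a fine partition inside one ball on
  -- which the local estimate holds.
  obtain ⟨δ, hδ, hball⟩ := lebesgue_number_lemma_of_metric (isCompact_Icc (a := a) (b := b))
    (c := fun τ : Icc a b => Metric.ball (τ : ℝ) (r τ)) (fun _ => Metric.isOpen_ball)
    fun x hx => mem_iUnion.2 ⟨⟨x, hx⟩, Metric.mem_ball_self (hr0 _)⟩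
  refine (taggedPartitions_hasBasis a b).eventually_iff.2 ⟨δ, hδ, fun p hp => ?_⟩
  obtain ⟨m, t, s⟩ := p
  change IsTaggedPartition a b δ m t s at hp
  have htel : Φ b - Φ a = ∑ k ∈ Finset.range m, (Φ (t (k + 1)) - Φ (t k)) := by
    rw [Finset.sum_range_sub (fun k => Φ (t k)), hp.left, hp.right]
  rw [dist_comm, dist_eq_norm, htel, contourSum, ← Finset.sum_sub_distrib]
  have hle : ‖∑ k ∈ Finset.range m,
      (Φ (t (k + 1)) - Φ (t k) - (γ (t (k + 1)) - γ (t k)) • F (γ (s k)))‖ ≤ 2 * η * V := by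
    refine le_trans ?_
      (mul_le_mul_of_nonneg_left (hp.sum_norm_le h.rectifiable) (by positivity))
    rw [Finset.mul_sum]
    refine norm_sum_le_of_le _ fun k hk => ?_
    rw [Finset.mem_range] at hk
    obtain ⟨τ, hτ⟩ := hball (s k) (hp.tag_mem_Icc hk)
    have hmem : ∀ x ∈ Icc (t k) (t (k + 1)), x ∈ Metric.ball (τ : ℝ) (r τ) := fun x hx =>
      hτ (by rw [Metric.mem_ball, Real.dist_eq]; exact hp.abs_sub_tag_lt hk hx)
    exact hr τ _ (hp.mem_Icc hk.le) _ (hp.mem_Icc hk) _ (hp.tag_mem_Icc hk)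
      (hmem _ (left_mem_Icc.2 (hp.mono k hk))) (hmem _ (right_mem_Icc.2 (hp.mono k hk)))
      (hmem _ (hp.tag k hk))
  refine hle.trans_lt ?_
  rw [hη, show 2 * (ε / (2 * (V + 1))) * V = ε * V / (V + 1) by field_simp,
    div_lt_iff₀ (by positivity)]
  nlinarith

/-- The integral of a derivative along a closed curve vanishes. -/
theorem hasContourIntegral_zero_of_primitive (h : IsRectifiableJordanCurve γ a b) {F G : ℂ → ℂ}
    (hF : ContinuousOn F (γ '' Icc a b))
    (hG : ∀ z ∈ γ '' Icc a b, HasStrictDerivAt G (F z) z) :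
    HasContourIntegral F γ a b 0 := by
  have := h.hasContourIntegral_of_local_primitive hF (Φ := G ∘ γ) fun τ hτ =>
    ⟨G, hG _ (mem_image_of_mem γ hτ), Eventually.of_forall fun _ => rfl⟩
  simpa [h.closed] using this

/-- `log |γ - w| + iθ` is a continuous logarithm of `γ - w` along the curve, hence a primitive along
it. The curve is closed, so the real parts cancel and only the increment of the argument remains. -/
theorem hasContourIntegral_sub_inv_of_hasWindingNumber (h : IsRectifiableJordanCurve γ a b)
    {w : ℂ} (hw : w ∉ γ '' Icc a b) {k : ℤ} (hk : HasWindingNumber γ a b w k) :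
    HasContourIntegral (fun z => (z - w)⁻¹) γ a b (2 * Real.pi * Complex.I * k) := by
  obtain ⟨θ, hθ, hγθ, hinc⟩ := hk
  have hne : ∀ τ ∈ Icc a b, γ τ - w ≠ 0 := fun τ hτ h0 =>
    hw ⟨τ, hτ, sub_eq_zero.1 h0⟩
  have hcont : ContinuousOn (fun z => (z - w)⁻¹) (γ '' Icc a b) := by
    refine ContinuousOn.inv₀ (by fun_prop) ?_
    rintro _ ⟨τ, hτ, rfl⟩
    exact hne τ hτ
  set ℓ : ℝ → ℂ := fun τ => (Real.log ‖γ τ - w‖ : ℂ) + θ τ * Complex.I with hℓ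
  have hexp : ∀ τ ∈ Icc a b, Complex.exp (ℓ τ) = γ τ - w := fun τ hτ => by
    rw [hℓ]
    simp only
    rw [Complex.exp_add, ← Complex.ofReal_exp, Real.exp_log (norm_pos_iff.2 (hne τ hτ)),
      ← hγθ τ hτ]
  have hℓc : ContinuousOn ℓ (Icc a b) := by
    refine ContinuousOn.add ?_ ?_
    · refine Complex.continuous_ofReal.comp_continuousOn ?_
      exact ContinuousOn.log (h.continuousOn.sub continuousOn_const).norm
        fun τ hτ => norm_ne_zero_iff.2 (hne τ hτ)
    · exact (Complex.continuous_ofReal.comp_continuousOn hθ).mul continuousOn_const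
  have := h.hasContourIntegral_of_local_primitive hcont (Φ := ℓ) fun τ hτ => by
    refine ⟨fun z => ℓ τ + Complex.log ((z - w) / (γ τ - w)), ?_, ?_⟩
    · have h1 : HasStrictDerivAt (fun z : ℂ => (z - w) / (γ τ - w)) (1 / (γ τ - w)) (γ τ) :=
        HasStrictDerivAt.div_const ((hasStrictDerivAt_id (γ τ)).sub_const w) _
      have h2 := (h1.clog (by simp [div_self (hne τ hτ)])).const_add (ℓ τ)
      simpa [div_self (hne τ hτ)] using h2
    -- Near `τ` the imaginary part of `ℓ t - ℓ τ` stays in `(-π, π)`, where the principal logarithm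
    -- inverts the exponential.
    · have him : Tendsto (fun t => (ℓ t - ℓ τ).im) (𝓝[Icc a b] τ) (𝓝 0) := by
        have h1 : Tendsto (fun t => ℓ t - ℓ τ) (𝓝[Icc a b] τ) (𝓝 (ℓ τ - ℓ τ)) :=
          (hℓc τ hτ).sub_const _
        rw [sub_self] at h1
        exact (Complex.continuous_im.tendsto 0).comp h1
      filter_upwards [him.eventually (Ioo_mem_nhds (neg_lt_zero.2 Real.pi_pos) Real.pi_pos),
        self_mem_nhdsWithin] with t ht htab
      rw [← hexp t htab, ← hexp τ hτ, ← Complex.exp_sub, Complex.log_exp ht.1 ht.2.le]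
      ring
  convert this using 1
  have hbr : (θ b : ℂ) - θ a = 2 * Real.pi * k := by exact_mod_cast hinc
  simp only [hℓ, h.closed]
  linear_combination (-Complex.I) * hbr

/-- The Riemann–Stieltjes sums of a continuous family of integrands converge locally uniformly in
the parameter. -/
theorem tendstoLocallyUniformlyOn_contourSum (h : IsRectifiableJordanCurve γ a b) {W : Set ℂ}
    (hW : IsOpen W) {φ : ℂ → ℂ → ℂ}
    (hφ : ContinuousOn (fun p : ℂ × ℂ => φ p.1 p.2) (W ×ˢ (γ '' Icc a b))) :
    TendstoLocallyUniformlyOn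
      (fun (p : ℕ × (ℕ → ℝ) × (ℕ → ℝ)) w => contourSum (φ w) γ p.1 p.2.1 p.2.2)
      (fun w => contourIntegral (φ w) γ a b) (taggedPartitions a b) W := by
  obtain ⟨V, hV, H⟩ := h.exists_norm_contourIntegral_sub_le
  rw [tendstoLocallyUniformlyOn_iff_forall_isCompact hW]
  intro C hCW hC
  rw [Metric.tendstoUniformlyOn_iff]
  intro ε hε
  have hφγ : ContinuousOn (fun p : ℂ × ℝ => φ p.1 (γ p.2)) (C ×ˢ Icc a b) := by
    refine ContinuousOn.comp (f := fun p : ℂ × ℝ => (p.1, γ p.2)) hφ ?_ ?_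
    · exact continuousOn_fst.prodMk (h.continuousOn.comp continuousOn_snd fun p hp => hp.2)
    · exact fun p hp => ⟨hCW hp.1, mem_image_of_mem γ hp.2⟩
  -- Joint uniform continuity on the compact product gives one mesh valid for all parameters in `C`.
  obtain ⟨δ, hδ, hu⟩ := Metric.uniformContinuousOn_iff.1
    ((hC.prod isCompact_Icc).uniformContinuousOn_of_continuous hφγ) (ε / (V + 1)) (by positivity)
  refine (taggedPartitions_hasBasis a b).eventually_iff.2 ⟨δ, hδ, fun p hp w hw => ?_⟩
  have hφw : ContinuousOn (φ w) (γ '' Icc a b) :=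
    ContinuousOn.comp (f := fun z : ℂ => (w, z)) hφ (by fun_prop) fun z hz => ⟨hCW hw, hz⟩
  rw [dist_eq_norm]
  refine ((H (φ w) hφw).2 (ε / (V + 1)) δ (fun x hx y hy hxy => ?_) _ _ _ hp).trans_lt ?_
  · rw [← dist_eq_norm]
    refine (hu (w, x) ⟨hw, hx⟩ (w, y) ⟨hw, hy⟩ ?_).le
    rw [Prod.dist_eq, dist_self]
    exact max_lt hδ hxy
  · rw [div_mul_eq_mul_div, div_lt_iff₀ (by positivity)]
    nlinarith

theorem eventually_differentiableOn_contourSum {W : Set ℂ} {φ : ℂ → ℂ → ℂ}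
    (hd : ∀ z ∈ γ '' Icc a b, DifferentiableOn ℂ (fun w => φ w z) W) :
    ∀ᶠ p in taggedPartitions a b,
      DifferentiableOn ℂ (fun w => contourSum (φ w) γ p.1 p.2.1 p.2.2) W := by
  refine (taggedPartitions_hasBasis a b).eventually_iff.2 ⟨1, one_pos, fun p hp => ?_⟩
  refine DifferentiableOn.fun_sum fun k hk => ?_
  simp only [smul_eq_mul]
  exact (hd _ (mem_image_of_mem γ (hp.tag_mem_Icc (Finset.mem_range.1 hk)))).const_mul _

/-- Weierstrass' theorem: the Riemann–Stieltjes sums are holomorphic in the parameter and converge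
locally uniformly. -/
theorem differentiableOn_contourIntegral (h : IsRectifiableJordanCurve γ a b) {W : Set ℂ}
    (hW : IsOpen W) {φ : ℂ → ℂ → ℂ}
    (hφ : ContinuousOn (fun p : ℂ × ℂ => φ p.1 p.2) (W ×ˢ (γ '' Icc a b)))
    (hd : ∀ z ∈ γ '' Icc a b, DifferentiableOn ℂ (fun w => φ w z) W) :
    DifferentiableOn ℂ (fun w => contourIntegral (φ w) γ a b) W :=
  have := taggedPartitions_neBot h.lt.le
  (h.tendstoLocallyUniformlyOn_contourSum hW hφ).differentiableOn
    (eventually_differentiableOn_contourSum hd) hW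

end IsRectifiableJordanCurve

/-! ### Difference quotients of holomorphic functions. -/

/-- Transfers holomorphy in the second variable to the first, the variable that is the parameter in
Dixon's argument. -/
theorem dslope_comm {g : ℂ → ℂ} (w z : ℂ) : dslope g w z = dslope g z w := by
  rcases eq_or_ne z w with rfl | h
  · rfl
  · rw [dslope_of_ne _ h, dslope_of_ne _ h.symm, slope_comm]

/-- The difference quotient of a holomorphic function is continuous in both variables. -/
theorem continuousOn_dslope_prod {g : ℂ → ℂ} {U : Set ℂ} (hU : IsOpen U)
    (hg : DifferentiableOn ℂ g U) :
    ContinuousOn (fun p : ℂ × ℂ => dslope g p.1 p.2) (U ×ˢ U) := by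
  rintro ⟨c, d⟩ ⟨hc, hd⟩
  have han : ∀ x ∈ U, AnalyticAt ℂ g x := fun x hx => hg.analyticAt (hU.mem_nhds hx)
  refine ContinuousAt.continuousWithinAt ?_
  rcases eq_or_ne d c with rfl | hne
  · rw [ContinuousAt, dslope_same, Metric.tendsto_nhds]
    intro ε hε
    -- At a diagonal point, strict differentiability controls nearby off-diagonal points and
    -- continuity of the derivative controls nearby diagonal ones.
    have h1 := ((han d hd).hasStrictDerivAt.hasStrictFDerivAt.isLittleO.bound (half_pos hε))
    have h2 : ∀ᶠ p : ℂ × ℂ in 𝓝 (d, d), dist (deriv g p.1) (deriv g d) < ε :=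
      ((han d hd).deriv.continuousAt.comp_of_eq continuousAt_fst rfl).eventually
        (Metric.ball_mem_nhds _ hε)
    filter_upwards [h1, h2] with p hp1 hp2
    rcases eq_or_ne p.2 p.1 with heq | hne
    · rwa [heq, dslope_same]
    · have h0 : p.1 - p.2 ≠ 0 := sub_ne_zero.2 hne.symm
      have h0' : 0 < ‖p.1 - p.2‖ := norm_pos_iff.2 h0
      rw [dslope_of_ne _ hne, slope_comm, slope_def_field, dist_eq_norm]
      have : (g p.1 - g p.2) / (p.1 - p.2) - deriv g d =
          (g p.1 - g p.2 - (p.1 - p.2) * deriv g d) / (p.1 - p.2) := by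
        field_simp
      rw [this, norm_div, div_lt_iff₀ h0']
      refine lt_of_le_of_lt ?_ (mul_lt_mul_of_pos_right (half_lt_self hε) h0')
      simpa using hp1
  · have hev : (fun p : ℂ × ℂ => dslope g p.1 p.2) =ᶠ[𝓝 (c, d)]
        fun p => (g p.2 - g p.1) / (p.2 - p.1) := by
      have : ∀ᶠ p : ℂ × ℂ in 𝓝 (c, d), p.2 ≠ p.1 :=
        (isOpen_ne_fun continuous_snd continuous_fst).mem_nhds hne
      filter_upwards [this] with p hp
      rw [dslope_of_ne _ hp, slope_def_field]
    refine ContinuousAt.congr ?_ hev.symm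
    refine ContinuousAt.div ?_ (by fun_prop) (sub_ne_zero.2 hne)
    exact ((han d hd).continuousAt.comp_of_eq continuousAt_snd rfl).sub
      ((han c hc).continuousAt.comp_of_eq continuousAt_fst rfl)

theorem analyticAt_dslope {g : ℂ → ℂ} {w z : ℂ} (hw : AnalyticAt ℂ g w) (hz : AnalyticAt ℂ g z) :
    AnalyticAt ℂ (dslope g w) z := by
  rcases eq_or_ne z w with rfl | hne
  · obtain ⟨p, hp⟩ := hz
    exact ⟨_, hp.has_fpower_series_dslope_fslope⟩
  · refine AnalyticAt.congr ?_ (dslope_eventuallyEq_slope_of_ne g hne).symm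
    simp only [slope_fun_def_field]
    exact (hz.sub analyticAt_const).div (analyticAt_id.sub analyticAt_const) (sub_ne_zero.2 hne)

/-! ### Winding numbers outside the curve, Dixon's theorem and Cauchy's formulas. -/

section EnclosedRegion

variable {γ : ℝ → ℂ} {a b : ℝ}

theorem not_isBounded_of_notMem {w : ℂ} (hw : w ∉ γ '' Icc a b ∪ enclosedRegion γ a b) :
    ¬ Bornology.IsBounded (connectedComponentIn (γ '' Icc a b)ᶜ w) := fun h =>
  hw (Or.inr ⟨fun h' => hw (Or.inl h'), h⟩)

end EnclosedRegion

namespace IsRectifiableJordanCurve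

variable {γ : ℝ → ℂ} {a b : ℝ}

theorem isOpen_compl_image (h : IsRectifiableJordanCurve γ a b) : IsOpen (γ '' Icc a b)ᶜ :=
  h.isCompact_image.isClosed.isOpen_compl

theorem isOpen_compl_image_union_enclosedRegion (h : IsRectifiableJordanCurve γ a b) :
    IsOpen (γ '' Icc a b ∪ enclosedRegion γ a b)ᶜ := by
  rw [isOpen_iff_mem_nhds]
  intro w hw
  have hwS : w ∈ (γ '' Icc a b)ᶜ := fun h' => hw (Or.inl h')
  refine mem_of_superset (h.isOpen_compl_image.connectedComponentIn.mem_nhds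
    (mem_connectedComponentIn hwS)) fun u hu => ?_
  rintro (h' | h')
  · exact connectedComponentIn_subset _ _ hu h'
  · refine not_isBounded_of_notMem hw ?_
    rw [connectedComponentIn_eq hu]
    exact h'.2

theorem exists_norm_le (h : IsRectifiableJordanCurve γ a b) :
    ∃ R : ℝ, ∀ z ∈ γ '' Icc a b, ‖z‖ ≤ R :=
  isBounded_iff_forall_norm_le.1 h.isCompact_image.isBounded

/-- The ray from `w` away from the origin avoids the curve; being connected and unbounded, it makes
the component of `w` unbounded. -/
theorem notMem_of_norm_lt {R : ℝ} (hR : ∀ z ∈ γ '' Icc a b, ‖z‖ ≤ R) (hR0 : 0 ≤ R) {w : ℂ}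
    (hw : R < ‖w‖) : w ∉ γ '' Icc a b ∪ enclosedRegion γ a b := by
  have hw0 : 0 < ‖w‖ := hR0.trans_lt hw
  have hray : (fun t : ℝ => (t : ℂ) * w) '' Ici 1 ⊆ (γ '' Icc a b)ᶜ := by
    rintro _ ⟨t, ht, rfl⟩ hmem
    have := hR _ hmem
    rw [norm_mul, Complex.norm_real, Real.norm_of_nonneg (zero_le_one.trans ht)] at this
    nlinarith [mem_Ici.1 ht]
  have hsub := IsPreconnected.subset_connectedComponentIn (x := w)
    (isPreconnected_Ici.image (fun t : ℝ => (t : ℂ) * w) (by fun_prop))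
    ⟨1, self_mem_Ici, by simp⟩ hray
  rintro (hS | ⟨-, hbd⟩)
  · exact absurd (hR w hS) (not_le.2 hw)
  · obtain ⟨C, hC⟩ := isBounded_iff_forall_norm_le.1 (hbd.subset hsub)
    have ht : max 1 ((C + 1) / ‖w‖) ∈ Ici (1 : ℝ) := mem_Ici.2 (le_max_left _ _)
    have := hC _ ⟨_, ht, rfl⟩
    rw [norm_mul, Complex.norm_real, Real.norm_of_nonneg (zero_le_one.trans ht)] at this
    have h2 : (C + 1) / ‖w‖ * ‖w‖ ≤ max 1 ((C + 1) / ‖w‖) * ‖w‖ :=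
      mul_le_mul_of_nonneg_right (le_max_right _ _) hw0.le
    rw [div_mul_cancel₀ _ hw0.ne'] at h2
    linarith

theorem continuousOn_sub_inv_prod (f : ℂ → ℂ) (hf : ContinuousOn f (γ '' Icc a b)) :
    ContinuousOn (fun p : ℂ × ℂ => f p.2 * (p.2 - p.1)⁻¹) ((γ '' Icc a b)ᶜ ×ˢ (γ '' Icc a b)) := by
  refine ContinuousOn.mul (hf.comp continuousOn_snd fun p hp => hp.2)
    (ContinuousOn.inv₀ (by fun_prop) ?_)
  rintro ⟨w, z⟩ ⟨hw, hz⟩ h0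
  exact hw (sub_eq_zero.1 h0 ▸ hz)

theorem hasDerivAt_sub_inv {w z : ℂ} (hzw : z ≠ w) (c : ℂ) :
    HasDerivAt (fun w => c * (z - w)⁻¹) (c * ((z - w)⁻¹) ^ 2) w := by
  have h1 : HasDerivAt (fun w => z - w) (-1) w := by
    simpa using (hasDerivAt_id w).const_sub z
  have := (h1.fun_inv (sub_ne_zero.2 hzw)).const_mul c
  simpa [inv_pow] using this

theorem differentiableOn_sub_inv (c : ℂ) {z : ℂ} (hz : z ∈ γ '' Icc a b) :
    DifferentiableOn ℂ (fun w => c * (z - w)⁻¹) (γ '' Icc a b)ᶜ := fun w hw =>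
  (hasDerivAt_sub_inv (fun h : z = w => hw (h ▸ hz)) c).differentiableAt.differentiableWithinAt

/-- An exponent of at least 2 admits a single-valued primitive. -/
theorem hasContourIntegral_sub_inv_pow (h : IsRectifiableJordanCurve γ a b) {w : ℂ}
    (hw : w ∉ γ '' Icc a b) (k : ℕ) :
    HasContourIntegral (fun z => ((z - w)⁻¹) ^ (k + 2)) γ a b 0 := by
  have hne : ∀ z ∈ γ '' Icc a b, z - w ≠ 0 := fun z hz h0 => hw (sub_eq_zero.1 h0 ▸ hz)
  refine h.hasContourIntegral_zero_of_primitive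
    (G := fun z => -((k : ℂ) + 1)⁻¹ * ((z - w)⁻¹) ^ (k + 1)) ?_ fun z hz => ?_
  · exact (ContinuousOn.inv₀ (by fun_prop) hne).pow _
  · have h1 : HasStrictDerivAt (fun z => z - w) 1 z := (hasStrictDerivAt_id z).sub_const w
    have h2 : HasStrictDerivAt (fun z => (z - w)⁻¹) (-((z - w) ^ 2)⁻¹ * 1) z :=
      (hasStrictDerivAt_inv (hne z hz)).comp z h1
    have h3 := (h2.fun_pow (k + 1)).const_mul (-((k : ℂ) + 1)⁻¹)
    refine h3.congr_deriv ?_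
    have hk : (k : ℂ) + 1 ≠ 0 := by exact_mod_cast k.succ_ne_zero
    have := hne z hz
    push_cast
    rw [pow_add _ k 2]
    field_simp

/-- The winding number about a point of the unbounded component vanishes. -/
theorem hasContourIntegral_sub_inv_of_notMem (h : IsRectifiableJordanCurve γ a b) {w : ℂ}
    (hw : w ∉ γ '' Icc a b ∪ enclosedRegion γ a b) :
    HasContourIntegral (fun z => (z - w)⁻¹) γ a b 0 := by
  have := taggedPartitions_neBot h.lt.le
  have hwS : w ∈ (γ '' Icc a b)ᶜ := fun h' => hw (Or.inl h')
  have hc := continuousOn_sub_inv_prod (γ := γ) (a := a) (b := b) (fun _ => 1) continuousOn_const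
  have hd : ∀ z ∈ γ '' Icc a b, DifferentiableOn ℂ (fun w => 1 * (z - w)⁻¹) (γ '' Icc a b)ᶜ :=
    fun z hz => differentiableOn_sub_inv 1 hz
  have hlim := h.tendstoLocallyUniformlyOn_contourSum h.isOpen_compl_image
    (φ := fun w z => 1 * (z - w)⁻¹) hc
  have hdiff := h.differentiableOn_contourIntegral h.isOpen_compl_image
    (φ := fun w z => 1 * (z - w)⁻¹) hc hd
  have hint : ∀ u ∈ (γ '' Icc a b)ᶜ, HasContourIntegral (fun z => 1 * (z - u)⁻¹) γ a b
      (contourIntegral (fun z => 1 * (z - u)⁻¹) γ a b) := fun u hu =>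
    h.hasContourIntegral
      (ContinuousOn.comp (f := fun z : ℂ => (u, z)) hc (by fun_prop) fun z hz => ⟨hu, hz⟩)
  -- Differentiating the sums in the parameter gives the sums for `(z - u)⁻²`, whose integral
  -- vanishes; hence the integral is constant on components.
  have hderiv : EqOn (deriv fun w => contourIntegral (fun z => 1 * (z - w)⁻¹) γ a b) 0
      (γ '' Icc a b)ᶜ := fun u hu => by
    refine tendsto_nhds_unique ((hlim.deriv (eventually_differentiableOn_contourSum hd)
      h.isOpen_compl_image).tendsto_at hu) ?_
    refine Tendsto.congr' ?_ (hasContourIntegral_iff_tendsto.1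
      (h.hasContourIntegral_sub_inv_pow hu 0))
    refine (taggedPartitions_hasBasis a b).eventually_iff.2 ⟨1, one_pos, fun p hp => ?_⟩
    refine HasDerivAt.deriv (HasDerivAt.fun_sum fun k hk => ?_) |>.symm
    have hk' := mem_image_of_mem γ (hp.tag_mem_Icc (Finset.mem_range.1 hk))
    simpa using (hasDerivAt_sub_inv (fun h' : γ (p.2.2 k) = u => hu (h' ▸ hk')) 1).const_mul
      (γ (p.2.1 (k + 1)) - γ (p.2.1 k))
  have hsub := connectedComponentIn_subset (γ '' Icc a b)ᶜ w
  have hconst : ∀ u ∈ connectedComponentIn (γ '' Icc a b)ᶜ w,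
      contourIntegral (fun z => 1 * (z - w)⁻¹) γ a b =
        contourIntegral (fun z => 1 * (z - u)⁻¹) γ a b := fun u hu =>
    h.isOpen_compl_image.connectedComponentIn.is_const_of_deriv_eq_zero
      isPreconnected_connectedComponentIn (hdiff.mono hsub) (hderiv.mono hsub)
      (mem_connectedComponentIn hwS) hu
  have hzero : contourIntegral (fun z => 1 * (z - w)⁻¹) γ a b = 0 := by
    by_contra hne
    set c := ‖contourIntegral (fun z => 1 * (z - w)⁻¹) γ a b‖
    have hc0 : 0 < c := norm_pos_iff.2 hne
    obtain ⟨R, hR⟩ := h.exists_norm_le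
    set V := (eVariationOn γ (Icc a b)).toReal
    have hV : 0 ≤ V := ENNReal.toReal_nonneg
    have hnb := not_isBounded_of_notMem hw
    rw [isBounded_iff_forall_norm_le] at hnb
    push Not at hnb
    -- At this distance every curve point is at least `V / c + 1` from `u`, so the integral has norm
    -- at most `V / (V / c + 1) < c`, against constancy on the component.
    obtain ⟨u, hu, hun⟩ := hnb (R + (V / c + 1))
    have hM : 0 < V / c + 1 := by positivity
    have hle := h.norm_le_of_hasContourIntegral (hint u (hsub hu)) (C := (V / c + 1)⁻¹)
      fun z hz => by
        rw [one_mul, norm_inv]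
        refine inv_anti₀ hM ?_
        have := norm_sub_norm_le u z
        rw [norm_sub_rev] at this
        linarith [hR z hz]
    rw [← hconst u hu] at hle
    change c ≤ _ at hle
    have : (V / c + 1)⁻¹ * V < c := by
      rw [inv_mul_lt_iff₀ hM, add_mul, div_mul_cancel₀ _ hc0.ne']
      linarith
    linarith
  have := hint w hwS
  rw [hzero] at this
  exact this.congr fun z _ => one_mul _

/-- Dixon's theorem: the difference quotient of a function that is holomorphic in a neighbourhood
of the closed curve and its inside has vanishing integral. -/
theorem contourIntegral_dslope_eq_zero (h : IsRectifiableJordanCurve γ a b) {g : ℂ → ℂ}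
    {U : Set ℂ} (hU : IsOpen U) (hKU : γ '' Icc a b ∪ enclosedRegion γ a b ⊆ U)
    (hg : DifferentiableOn ℂ g U) {w : ℂ} (hw : w ∈ U) :
    contourIntegral (dslope g w) γ a b = 0 := by
  classical
  have hSU : γ '' Icc a b ⊆ U := subset_union_left.trans hKU
  have hgS : ContinuousOn g (γ '' Icc a b) := hg.continuousOn.mono hSU
  have hcd := (continuousOn_dslope_prod hU hg).mono (prod_mono_right (s := U) hSU)
  have hcq := continuousOn_sub_inv_prod g hgS
  have hint : ∀ u ∈ (γ '' Icc a b)ᶜ, HasContourIntegral (fun z => g z * (z - u)⁻¹) γ a b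
      (contourIntegral (fun z => g z * (z - u)⁻¹) γ a b) := fun u hu =>
    h.hasContourIntegral
      (ContinuousOn.comp (f := fun z : ℂ => (u, z)) hcq (by fun_prop) fun z hz => ⟨hu, hz⟩)
  -- Dixon's entire function, glued from two integrals that agree where both are used.
  set H : ℂ → ℂ := fun u => if u ∈ U then contourIntegral (dslope g u) γ a b else
    contourIntegral (fun z => g z * (z - u)⁻¹) γ a b
  have hHU : EqOn H (fun u => contourIntegral (dslope g u) γ a b) U := fun u hu => if_pos hu
  have hHq : EqOn H (fun u => contourIntegral (fun z => g z * (z - u)⁻¹) γ a b)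
      (γ '' Icc a b ∪ enclosedRegion γ a b)ᶜ := fun u hu => by
    have huS : u ∈ (γ '' Icc a b)ᶜ := fun h' => hu (Or.inl h')
    by_cases huU : u ∈ U
    · rw [hHU huU]
      refine HasContourIntegral.contourIntegral_eq h.lt.le ?_
      -- The two integrands differ by `g u / (z - u)`, which integrates to 0 because the winding
      -- number about `u` is 0.
      have := (hint u huS).add ((h.hasContourIntegral_sub_inv_of_notMem hu).const_smul (-g u))
      rw [smul_zero, add_zero] at this
      refine this.congr fun z hz => ?_
      have hzu : z ≠ u := fun h' => huS (h' ▸ hz)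
      simp only [dslope_of_ne _ hzu, slope_def_field, smul_eq_mul]
      ring
    · exact if_neg huU
  have hHd : Differentiable ℂ H := fun u => by
    by_cases huU : u ∈ U
    · have := h.differentiableOn_contourIntegral hU (φ := dslope g) hcd fun z hz => by
        simp only [fun u => dslope_comm (g := g) u z]
        exact (Complex.differentiableOn_dslope (hU.mem_nhds (hSU hz))).2 hg
      exact (this.differentiableAt (hU.mem_nhds huU)).congr_of_eventuallyEq
        (hHU.eventuallyEq_of_mem (hU.mem_nhds huU))
    · have huK : u ∈ (γ '' Icc a b ∪ enclosedRegion γ a b)ᶜ := fun h' => huU (hKU h')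
      have := h.differentiableOn_contourIntegral h.isOpen_compl_image
        (φ := fun u z => g z * (z - u)⁻¹) hcq fun z hz => differentiableOn_sub_inv _ hz
      exact (this.differentiableAt (h.isOpen_compl_image.mem_nhds fun h' => huK
        (Or.inl h'))).congr_of_eventuallyEq
        (hHq.eventuallyEq_of_mem (h.isOpen_compl_image_union_enclosedRegion.mem_nhds huK))
  obtain ⟨R₀, hR₀⟩ := h.exists_norm_le
  obtain ⟨M, hM⟩ := h.isCompact_image.exists_bound_of_continuousOn hgS
  have hM0 : 0 ≤ M :=
    (norm_nonneg _).trans (hM _ (mem_image_of_mem γ (left_mem_Icc.2 h.lt.le)))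
  set R := max R₀ 0
  have hR : ∀ z ∈ γ '' Icc a b, ‖z‖ ≤ R := fun z hz => (hR₀ z hz).trans (le_max_left _ _)
  have hH0 : Tendsto H (cocompact ℂ) (𝓝 0) := by
    have hlim : Tendsto (fun u : ℂ => M * (‖u‖ - R)⁻¹ * (eVariationOn γ (Icc a b)).toReal)
        (cocompact ℂ) (𝓝 0) := by
      have h1 : Tendsto (fun u : ℂ => ‖u‖ - R) (cocompact ℂ) atTop :=
        tendsto_atTop_add_const_right _ (-R) (tendsto_norm_cocompact_atTop (E := ℂ))
      simpa using (h1.inv_tendsto_atTop.const_mul M).mul_const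
        (eVariationOn γ (Icc a b)).toReal
    refine squeeze_zero_norm' ?_ hlim
    filter_upwards [(tendsto_norm_cocompact_atTop (E := ℂ)).eventually_gt_atTop R] with u hu
    have huK := notMem_of_norm_lt hR (le_max_right _ _) hu
    rw [hHq huK]
    refine h.norm_le_of_hasContourIntegral (hint u fun h' => huK (Or.inl h')) fun z hz => ?_
    rw [norm_mul, norm_inv]
    refine mul_le_mul (hM z hz) (inv_anti₀ (sub_pos.2 hu) ?_) (by positivity) hM0
    have := norm_sub_norm_le u z
    rw [norm_sub_rev] at this
    linarith [hR z hz]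
  exact (hHU hw).symm.trans (hHd.apply_eq_of_tendsto_cocompact w hH0)

/-- Cauchy's theorem for a rectifiable Jordan curve. -/
theorem hasContourIntegral_zero_of_analyticOnNhd (h : IsRectifiableJordanCurve γ a b) {w : ℂ}
    (hw : w ∈ enclosedRegion γ a b) {g : ℂ → ℂ}
    (hg : AnalyticOnNhd ℂ g (γ '' Icc a b ∪ enclosedRegion γ a b)) :
    HasContourIntegral g γ a b 0 := by
  -- Dixon's theorem is applied to `(z - w) g(z)`, whose difference quotient at `w` is `g` on the
  -- curve.
  have hgU : DifferentiableOn ℂ (fun z => (z - w) • g z) {z | AnalyticAt ℂ g z} := fun z hz =>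
    ((by fun_prop : DifferentiableAt ℂ (fun z : ℂ => z - w) z).smul
      (AnalyticAt.differentiableAt hz)).differentiableWithinAt
  have h0 := h.contourIntegral_dslope_eq_zero (isOpen_analyticAt ℂ g) hg hgU
    (w := w) (hg w (Or.inr hw))
  have hc : ContinuousOn g (γ '' Icc a b) := fun z hz =>
    (hg z (Or.inl hz)).continuousAt.continuousWithinAt
  have heq : EqOn g (dslope (fun z => (z - w) • g z) w) (γ '' Icc a b) := fun z hz =>
    (dslope_sub_smul_of_ne g fun h' : z = w => hw.1 (h' ▸ hz)).symm
  have := h.hasContourIntegral (hc.congr heq.symm)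
  rw [h0] at this
  exact this.congr heq.symm

/-- Cauchy's integral formula for the coefficients of the Taylor series. -/
theorem hasContourIntegral_mul_sub_inv_pow (h : IsRectifiableJordanCurve γ a b)
    (ho : IsPositivelyOriented γ a b) {w : ℂ} (hw : w ∈ enclosedRegion γ a b) (l : ℕ) :
    ∀ {f : ℂ → ℂ} {p : FormalMultilinearSeries ℂ ℂ ℂ},
      AnalyticOnNhd ℂ f (γ '' Icc a b ∪ enclosedRegion γ a b) → HasFPowerSeriesAt f p w →
      HasContourIntegral (fun z => f z * ((z - w)⁻¹) ^ (l + 1)) γ a b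
        (2 * Real.pi * Complex.I * p.coeff l) := by
  have hne : ∀ z ∈ γ '' Icc a b, z - w ≠ 0 := fun z hz h0 => hw.1 (sub_eq_zero.1 h0 ▸ hz)
  -- From `f(z) = f(w) + (z - w) dslope f w z`: the constant contributes the winding number or 0,
  -- and the quotient lowers the exponent by one while shifting the Taylor coefficients.
  have hsplit : ∀ (f : ℂ → ℂ) (k : ℕ), EqOn
      (fun z => f w • ((z - w)⁻¹) ^ (k + 1) + dslope f w z * ((z - w)⁻¹) ^ k)
      (fun z => f z * ((z - w)⁻¹) ^ (k + 1)) (γ '' Icc a b) := fun f k z hz => by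
    have h1 := sub_smul_dslope f w z
    rw [smul_eq_mul] at h1
    have h2 := hne z hz
    simp only [smul_eq_mul, pow_succ]
    rw [← sub_add_cancel (f z) (f w), ← h1]
    field_simp
    ring
  have hds : ∀ {f : ℂ → ℂ}, AnalyticOnNhd ℂ f (γ '' Icc a b ∪ enclosedRegion γ a b) →
      AnalyticOnNhd ℂ (dslope f w) (γ '' Icc a b ∪ enclosedRegion γ a b) := fun hf z hz =>
    analyticAt_dslope (hf w (Or.inr hw)) (hf z hz)
  induction l with
  | zero =>
    intro f p hf hp
    have h1 := (h.hasContourIntegral_sub_inv_of_hasWindingNumber hw.1 (ho w hw)).const_smul (f w)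
    have h2 := h1.add (h.hasContourIntegral_zero_of_analyticOnNhd hw (hds hf))
    have hcoeff : p.coeff 0 = f w := hp.coeff_zero _
    convert h2.congr (fun z hz => ?_) using 1
    · rw [hcoeff, smul_eq_mul]
      push_cast
      ring
    · simpa using hsplit f 0 hz
  | succ l ih =>
    intro f p hf hp
    have h1 := (h.hasContourIntegral_sub_inv_pow hw.1 l).const_smul (f w)
    have h2 := h1.add (ih (hds hf) hp.has_fpower_series_dslope_fslope)
    rw [smul_zero, zero_add, FormalMultilinearSeries.coeff_fslope] at h2
    exact h2.congr (hsplit f (l + 1))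

theorem hasContourIntegral_mul_sub_inv_pow_iteratedDeriv (h : IsRectifiableJordanCurve γ a b)
    (ho : IsPositivelyOriented γ a b) {w : ℂ} (hw : w ∈ enclosedRegion γ a b) {f : ℂ → ℂ}
    (hf : AnalyticOnNhd ℂ f (γ '' Icc a b ∪ enclosedRegion γ a b)) (l : ℕ) :
    HasContourIntegral (fun z => f z * ((z - w)⁻¹) ^ (l + 1)) γ a b
      (2 * Real.pi * Complex.I * (iteratedDeriv l f w / (l.factorial : ℂ))) := by
  simpa [FormalMultilinearSeries.coeff_ofScalars] using
    h.hasContourIntegral_mul_sub_inv_pow ho hw l hf (hf w (Or.inr hw)).hasFPowerSeriesAt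

end IsRectifiableJordanCurve

/-! ### Spectral splitting of the resolvent. -/

namespace Matrix

variable {n : ℕ} (A : Matrix (Fin n) (Fin n) ℂ) (μ : ℂ)

theorem characteristicProjection_mulVec (v : Fin n → ℂ) :
    characteristicProjection A μ *ᵥ v = Submodule.projection (characteristicSpace A μ)
      (⨆ (ν : ℂ) (_ : ν ≠ μ), characteristicSpace A ν) (isCompl_characteristicSpace A μ) v := by
  rw [characteristicProjection, LinearMap.toMatrix'_mulVec]

theorem characteristicProjection_mulVec_mem (v : Fin n → ℂ) :
    characteristicProjection A μ *ᵥ v ∈ characteristicSpace A μ := by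
  rw [characteristicProjection_mulVec]
  exact Submodule.projection_apply_mem _ _

theorem characteristicProjection_mulVec_eq_self {v : Fin n → ℂ}
    (hv : v ∈ characteristicSpace A μ) : characteristicProjection A μ *ᵥ v = v := by
  rw [characteristicProjection_mulVec]
  exact Submodule.projection_apply_of_mem_left _ hv

theorem characteristicProjection_mul_self :
    characteristicProjection A μ * characteristicProjection A μ = characteristicProjection A μ := by
  refine Matrix.ext_of_mulVec_single fun i => ?_
  rw [← mulVec_mulVec, characteristicProjection_mulVec_eq_self A μ
    (characteristicProjection_mulVec_mem A μ _)]

theorem mulVec_mem_characteristicSpace (ν : ℂ) {v : Fin n → ℂ} (hv : v ∈ characteristicSpace A ν) :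
    A *ᵥ v ∈ characteristicSpace A ν := by
  rw [characteristicSpace, LinearMap.mem_ker, toLin'_apply] at hv ⊢
  have hc : Commute ((A - ν • 1) ^ A.charpoly.rootMultiplicity ν) A :=
    ((Commute.refl A).sub_left ((Commute.one_left A).smul_left ν)).pow_left _
  rw [mulVec_mulVec, hc.eq, ← mulVec_mulVec, hv, mulVec_zero]

/-- `A` preserves both the range and the kernel of the projection. -/
theorem commute_characteristicProjection : Commute A (characteristicProjection A μ) := by
  have hq : ∀ v ∈ ⨆ (ν : ℂ) (_ : ν ≠ μ), characteristicSpace A ν,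
      A *ᵥ v ∈ ⨆ (ν : ℂ) (_ : ν ≠ μ), characteristicSpace A ν := by
    intro v hv
    have : (⨆ (ν : ℂ) (_ : ν ≠ μ), characteristicSpace A ν) ≤
        (⨆ (ν : ℂ) (_ : ν ≠ μ), characteristicSpace A ν).comap (toLin' A) := by
      refine iSup₂_le fun ν hν w hw => ?_
      rw [Submodule.mem_comap, toLin'_apply]
      exact (le_iSup₂_of_le (f := fun (ν : ℂ) (_ : ν ≠ μ) => characteristicSpace A ν) ν hν le_rfl)
        (mulVec_mem_characteristicSpace A ν hw)
    simpa [toLin'_apply] using this hv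
  refine Matrix.ext_of_mulVec_single fun i => ?_
  set v : Fin n → ℂ := Pi.single i 1
  rw [← mulVec_mulVec, ← mulVec_mulVec]
  have hsub : v - characteristicProjection A μ *ᵥ v ∈
      ⨆ (ν : ℂ) (_ : ν ≠ μ), characteristicSpace A ν := by
    rw [characteristicProjection_mulVec]
    exact Submodule.sub_projection_mem _ _
  have h0 : characteristicProjection A μ *ᵥ (A *ᵥ (v - characteristicProjection A μ *ᵥ v)) = 0 := by
    rw [characteristicProjection_mulVec, Submodule.projection_apply_eq_zero_iff]
    exact hq _ hsub
  rw [mulVec_sub, mulVec_sub, sub_eq_zero, characteristicProjection_mulVec_eq_self A μ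
    (mulVec_mem_characteristicSpace A μ (characteristicProjection_mulVec_mem A μ v))] at h0
  exact h0.symm

theorem sub_smul_one_pow_mul_characteristicProjection :
    (A - μ • 1) ^ A.charpoly.rootMultiplicity μ * characteristicProjection A μ = 0 := by
  refine Matrix.ext_of_mulVec_single fun i => ?_
  rw [← mulVec_mulVec, zero_mulVec]
  have := characteristicProjection_mulVec_mem A μ (Pi.single i 1)
  rwa [characteristicSpace, LinearMap.mem_ker, toLin'_apply] at this

theorem commute_sub_smul_one_characteristicProjection :
    Commute (A - μ • 1) (characteristicProjection A μ) :=
  (commute_characteristicProjection A μ).sub_left ((Commute.one_left _).smul_left μ)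

theorem commute_nilpotentPart : Commute (nilpotentPart A μ) (characteristicProjection A μ) :=
  (commute_sub_smul_one_characteristicProjection A μ).mul_left (Commute.refl _)

theorem nilpotentPart_mul_characteristicProjection :
    nilpotentPart A μ * characteristicProjection A μ = nilpotentPart A μ := by
  rw [nilpotentPart, mul_assoc, characteristicProjection_mul_self]

theorem rootMultiplicity_pos_of_mem_spectrum {μ : ℂ} (hμ : μ ∈ spectrum ℂ A) :
    0 < A.charpoly.rootMultiplicity μ :=
  (Polynomial.rootMultiplicity_pos A.charpoly_monic.ne_zero).2
    (mem_spectrum_iff_isRoot_charpoly.1 hμ)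

theorem nilpotentPart_pow_rootMultiplicity {μ : ℂ} (hμ : μ ∈ spectrum ℂ A) :
    nilpotentPart A μ ^ A.charpoly.rootMultiplicity μ = 0 := by
  have hP : IsIdempotentElem (characteristicProjection A μ) :=
    characteristicProjection_mul_self A μ
  rw [nilpotentPart, (commute_sub_smul_one_characteristicProjection A μ).mul_pow,
    hP.pow_eq (rootMultiplicity_pos_of_mem_spectrum A hμ).ne',
    sub_smul_one_pow_mul_characteristicProjection]

/-- The finite Neumann series. -/
theorem smul_one_sub_mul_sum_inv_pow (N : Matrix (Fin n) (Fin n) ℂ) {c : ℂ} (hc : c ≠ 0) (r : ℕ) :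
    (c • 1 - N) * ∑ l ∈ Finset.range r, (c⁻¹) ^ (l + 1) • N ^ l = 1 - (c⁻¹) ^ r • N ^ r := by
  induction r with
  | zero => simp
  | succ r ih =>
    rw [Finset.sum_range_succ, mul_add, ih, sub_mul, smul_mul_smul_comm, one_mul, mul_smul_comm,
      ← pow_succ', pow_succ' c⁻¹ r, mul_inv_cancel_left₀ hc]
    abel

theorem smul_one_sub_inv_of_nilpotent {N : Matrix (Fin n) (Fin n) ℂ} {r : ℕ} (hN : N ^ r = 0)
    {z : ℂ} (hz : z ≠ μ) :
    (z • 1 - (μ • 1 + N)) * ∑ l ∈ Finset.range r, ((z - μ)⁻¹) ^ (l + 1) • N ^ l = 1 := by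
  have := smul_one_sub_mul_sum_inv_pow N (sub_ne_zero.2 hz) r
  rwa [hN, smul_zero, sub_zero, sub_smul, sub_sub] at this

theorem spectrum_smul_one_add_of_nilpotent [Nontrivial (Matrix (Fin n) (Fin n) ℂ)]
    {N : Matrix (Fin n) (Fin n) ℂ} {r : ℕ} (hN : N ^ r = 0) :
    spectrum ℂ (μ • 1 + N) = {μ} := by
  ext z
  rw [mem_singleton_iff, spectrum.mem_iff, Algebra.algebraMap_eq_smul_one]
  constructor
  · contrapose!
    exact fun hz => IsUnit.of_mul_eq_one _ (smul_one_sub_inv_of_nilpotent μ hN hz)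
  · rintro rfl hu
    rw [sub_add_cancel_left] at hu
    have := (hu.neg).pow r
    rw [neg_neg, hN] at this
    exact not_isUnit_zero this

/-- The resolvent of `A` on the characteristic space of `μ`. -/
theorem inv_mul_characteristicProjection {μ : ℂ} (hμ : μ ∈ spectrum ℂ A) {z : ℂ}
    (hz : z ∉ spectrum ℂ A) :
    (z • 1 - A)⁻¹ * characteristicProjection A μ =
      ∑ l ∈ Finset.range (A.charpoly.rootMultiplicity μ),
        ((z - μ)⁻¹) ^ (l + 1) • (nilpotentPart A μ ^ l * characteristicProjection A μ) := by
  have hzμ : z ≠ μ := fun h => hz (h ▸ hμ)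
  have hunit : IsUnit (z • 1 - A).det := by
    rw [← isUnit_iff_isUnit_det, ← Algebra.algebraMap_eq_smul_one]
    exact spectrum.notMem_iff.1 hz
  have h1 := smul_one_sub_inv_of_nilpotent μ (nilpotentPart_pow_rootMultiplicity A hμ) hzμ
  set P := characteristicProjection A μ
  -- `A` and `μ + N` agree on the range of `P`, so the Neumann series for `μ + N` inverts `z - A`
  -- there.
  have hkey : (z • 1 - A) * P = (z • 1 - (μ • 1 + nilpotentPart A μ)) * P := by
    rw [sub_mul, sub_mul, add_mul, nilpotentPart_mul_characteristicProjection, nilpotentPart,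
      sub_mul]
    abel
  have hc : Commute (∑ l ∈ Finset.range (A.charpoly.rootMultiplicity μ),
      ((z - μ)⁻¹) ^ (l + 1) • nilpotentPart A μ ^ l) P :=
    Commute.sum_left _ _ _ fun l _ => ((commute_nilpotentPart A μ).pow_left l).smul_left _
  have hcz : Commute (z • 1 - (μ • 1 + nilpotentPart A μ)) P :=
    ((Commute.one_left P).smul_left z).sub_left
      (((Commute.one_left P).smul_left μ).add_left (commute_nilpotentPart A μ))
  simp only [← smul_mul_assoc, ← Finset.sum_mul]
  rw [hc.eq]
  calc (z • 1 - A)⁻¹ * P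
      = (z • 1 - A)⁻¹ * (P * ((z • 1 - (μ • 1 + nilpotentPart A μ)) *
          ∑ l ∈ Finset.range (A.charpoly.rootMultiplicity μ),
            ((z - μ)⁻¹) ^ (l + 1) • nilpotentPart A μ ^ l)) := by rw [h1, mul_one]
    _ = (z • 1 - A)⁻¹ * ((z • 1 - A) * (P *
          ∑ l ∈ Finset.range (A.charpoly.rootMultiplicity μ),
            ((z - μ)⁻¹) ^ (l + 1) • nilpotentPart A μ ^ l)) := by
        rw [← mul_assoc P, ← hcz.eq, ← hkey, mul_assoc]
    _ = _ := nonsing_inv_mul_cancel_left _ _ hunit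

/-- `z - A` on the characteristic spaces other than that of `μ`, and the identity on the latter. -/
noncomputable def complementaryPencil (z : ℂ) : Matrix (Fin n) (Fin n) ℂ :=
  (z • 1 - A) * (1 - characteristicProjection A μ) + characteristicProjection A μ

theorem commute_smul_one_sub_characteristicProjection (z : ℂ) :
    Commute (z • 1 - A) (characteristicProjection A μ) :=
  ((Commute.one_left _).smul_left z).sub_left (commute_characteristicProjection A μ)

/-- Let `P` be the projection and `B` the pencil. A kernel vector `v` of `B` has `P v = 0`, since `P
B = P`, and therefore `(z - A) v = 0`. Off the spectrum this forces `v = 0`; if `z = μ` is an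
eigenvalue, `v` lies in its characteristic space, so `v = P v = 0`. -/
theorem det_complementaryPencil_ne_zero {z : ℂ} (hz : z = μ ∨ z ∉ spectrum ℂ A) :
    (complementaryPencil A μ z).det ≠ 0 := by
  intro hdet
  obtain ⟨v, hv0, hv⟩ := exists_mulVec_eq_zero_iff.2 hdet
  have hP := characteristicProjection_mul_self A μ
  have hc := commute_smul_one_sub_characteristicProjection A μ z
  have hPB : characteristicProjection A μ * complementaryPencil A μ z =
      characteristicProjection A μ := by
    rw [complementaryPencil, mul_add, hP, ← mul_assoc, ← hc.eq, mul_assoc, mul_sub, hP, mul_one,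
      sub_self, mul_zero, zero_add]
  have hPv : characteristicProjection A μ *ᵥ v = 0 := by
    rw [← hPB, ← mulVec_mulVec, hv, mulVec_zero]
  have hzv : (z • 1 - A) *ᵥ v = 0 := by
    rwa [complementaryPencil, add_mulVec, hPv, add_zero, ← mulVec_mulVec,
      sub_mulVec 1, hPv,
      one_mulVec, sub_zero] at hv
  rcases hz with rfl | hz
  · by_cases hμ : z ∈ spectrum ℂ A
    · refine hv0 ?_
      rw [← hPv, characteristicProjection_mulVec_eq_self]
      rw [characteristicSpace, LinearMap.mem_ker, toLin'_apply,
        ← Nat.sub_add_cancel (rootMultiplicity_pos_of_mem_spectrum A hμ), pow_succ,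
        ← mulVec_mulVec, ← neg_sub (z • 1) A, neg_mulVec, hzv, neg_zero, mulVec_zero]
    · refine hμ (spectrum.mem_iff.2 fun hu => ?_)
      rw [Algebra.algebraMap_eq_smul_one, isUnit_iff_isUnit_det, isUnit_iff_ne_zero] at hu
      exact hu (exists_mulVec_eq_zero_iff.1 ⟨v, hv0, hzv⟩)
  · rw [spectrum.notMem_iff, Algebra.algebraMap_eq_smul_one, isUnit_iff_isUnit_det,
      isUnit_iff_ne_zero] at hz
    exact hz (exists_mulVec_eq_zero_iff.1 ⟨v, hv0, hzv⟩)

/-- The resolvent of `A` on the characteristic spaces other than that of `μ`. -/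
theorem inv_mul_one_sub_characteristicProjection {z : ℂ} (hz : z ∉ spectrum ℂ A) :
    (z • 1 - A)⁻¹ * (1 - characteristicProjection A μ) =
      (1 - characteristicProjection A μ) * (complementaryPencil A μ z)⁻¹ := by
  have hunit : IsUnit (z • 1 - A).det := by
    rw [← isUnit_iff_isUnit_det, ← Algebra.algebraMap_eq_smul_one]
    exact spectrum.notMem_iff.1 hz
  have hB : IsUnit (complementaryPencil A μ z).det :=
    isUnit_iff_ne_zero.2 (det_complementaryPencil_ne_zero A μ (Or.inr hz))
  have hP := characteristicProjection_mul_self A μ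
  have hc := commute_smul_one_sub_characteristicProjection A μ z
  set P := characteristicProjection A μ
  have hQB : (1 - P) * complementaryPencil A μ z = (z • 1 - A) * (1 - P) := by
    have h1 : (1 - P) * (z • 1 - A) = (z • 1 - A) * (1 - P) :=
      ((Commute.one_left _).sub_left hc.symm).eq
    have h2 : (1 - P) * (1 - P) = 1 - P := by
      rw [sub_mul, one_mul, mul_sub, mul_one, hP, sub_self, sub_zero]
    have h3 : (1 - P) * P = 0 := by rw [sub_mul, one_mul, hP, sub_self]
    rw [complementaryPencil, mul_add, h3, add_zero, ← mul_assoc, h1, mul_assoc, h2]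
  calc (z • 1 - A)⁻¹ * (1 - P)
      = (z • 1 - A)⁻¹ * ((1 - P) * complementaryPencil A μ z * (complementaryPencil A μ z)⁻¹) := by
        rw [mul_nonsing_inv_cancel_right _ _ hB]
    _ = _ := by rw [hQB, mul_assoc, nonsing_inv_mul_cancel_left _ _ hunit]

theorem analyticAt_det {M : ℂ → Matrix (Fin n) (Fin n) ℂ} {z : ℂ}
    (hM : ∀ i j, AnalyticAt ℂ (fun w => M w i j) z) : AnalyticAt ℂ (fun w => (M w).det) z := by
  simp only [det_apply']
  exact Finset.analyticAt_fun_sum _ fun σ _ =>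
    analyticAt_const.mul (Finset.analyticAt_fun_prod _ fun i _ => hM _ _)

/-- Cramer's rule: the entries are quotients of determinants with nonvanishing denominator at `z`.
-/
theorem analyticAt_inv {M : ℂ → Matrix (Fin n) (Fin n) ℂ} {z : ℂ}
    (hM : ∀ i j, AnalyticAt ℂ (fun w => M w i j) z) (hz : (M z).det ≠ 0) (i j : Fin n) :
    AnalyticAt ℂ (fun w => (M w)⁻¹ i j) z := by
  simp only [inv_def, smul_apply, Ring.inverse_eq_inv', smul_eq_mul, adjugate_apply]
  refine ((analyticAt_det hM).inv hz).mul (analyticAt_det fun k l => ?_)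
  by_cases hk : k = j
  · simp only [hk, updateRow_self]
    exact analyticAt_const
  · simp only [updateRow_ne hk]
    exact hM k l

theorem analyticAt_complementaryPencil (z : ℂ) (i j : Fin n) :
    AnalyticAt ℂ (fun w => complementaryPencil A μ w i j) z := by
  simp only [complementaryPencil, add_apply, sub_mul, sub_apply, smul_mul_assoc, one_mul,
    smul_apply, smul_eq_mul]
  fun_prop

end Matrix

/-! ### Matrix-valued integrals and the conclusion. -/

theorem hasContourIntegral_matrix {n : ℕ} {F : ℂ → Matrix (Fin n) (Fin n) ℂ} {γ : ℝ → ℂ} {a b : ℝ}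
    {J : Matrix (Fin n) (Fin n) ℂ}
    (h : ∀ i j, HasContourIntegral (fun z => F z i j) γ a b (J i j)) :
    HasContourIntegral F γ a b J := by
  rw [hasContourIntegral_iff_tendsto]
  refine tendsto_pi_nhds.2 fun i => tendsto_pi_nhds.2 fun j => ?_
  refine (hasContourIntegral_iff_tendsto.1 (h i j)).congr fun p => ?_
  simp [contourSum, Matrix.sum_apply]

/-- The matrix function `f (μ + N)` of a nilpotent perturbation of a scalar. -/
theorem IsRectifiableJordanCurve.hasContourIntegral_cauchyIntegrand_of_nilpotent {n : ℕ}
    {γ : ℝ → ℂ} {a b : ℝ} (h : IsRectifiableJordanCurve γ a b)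
    (ho : IsPositivelyOriented γ a b) {μ : ℂ} (hμ : μ ∈ enclosedRegion γ a b) {f : ℂ → ℂ}
    (hf : AnalyticOnNhd ℂ f (γ '' Icc a b ∪ enclosedRegion γ a b))
    {N : Matrix (Fin n) (Fin n) ℂ} {r : ℕ} (hN : N ^ r = 0) :
    HasContourIntegral (cauchyIntegrand f (μ • 1 + N)) γ a b
      ((2 * Real.pi * Complex.I : ℂ) •
        ∑ l ∈ Finset.range r, (iteratedDeriv l f μ / (l.factorial : ℂ)) • N ^ l) := by
  have := HasContourIntegral.sum (Finset.range r) fun l _ =>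
    (h.hasContourIntegral_mul_sub_inv_pow_iteratedDeriv ho hμ hf l).smul_const (N ^ l)
  simp only [Finset.smul_sum, smul_smul]
  refine this.congr fun z hz => ?_
  have hzμ : z ≠ μ := fun h' => hμ.1 (h' ▸ hz)
  simp only [cauchyIntegrand]
  rw [Matrix.inv_eq_right_inv (Matrix.smul_one_sub_inv_of_nilpotent μ hN hzμ), Finset.smul_sum]
  simp only [smul_smul]

/-- The singular part of the resolvent, cut out by the projection, yields the Taylor sum; the
remainder coincides on the curve with a function analytic on and inside it. -/
theorem IsRectifiableJordanCurve.hasContourIntegral_cauchyIntegrand {n : ℕ}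
    {A : Matrix (Fin n) (Fin n) ℂ} {μ : ℂ} {γ : ℝ → ℂ} {a b : ℝ}
    (h : IsRectifiableJordanCurve γ a b) (ho : IsPositivelyOriented γ a b)
    (hcurve : Disjoint (spectrum ℂ A) (γ '' Icc a b))
    (hregion : spectrum ℂ A ∩ enclosedRegion γ a b = {μ}) {f : ℂ → ℂ}
    (hf : AnalyticOnNhd ℂ f (γ '' Icc a b ∪ enclosedRegion γ a b)) :
    HasContourIntegral (cauchyIntegrand f A) γ a b
      ((2 * Real.pi * Complex.I : ℂ) • ∑ l ∈ Finset.range (A.charpoly.rootMultiplicity μ),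
        (iteratedDeriv l f μ / (l.factorial : ℂ)) •
          (nilpotentPart A μ ^ l * characteristicProjection A μ)) := by
  obtain ⟨hμA, hμ⟩ : μ ∈ spectrum ℂ A ∩ enclosedRegion γ a b := hregion ▸ mem_singleton μ
  have hsum := HasContourIntegral.sum (Finset.range (A.charpoly.rootMultiplicity μ)) fun l _ =>
    (h.hasContourIntegral_mul_sub_inv_pow_iteratedDeriv ho hμ hf l).smul_const
      (nilpotentPart A μ ^ l * characteristicProjection A μ)
  -- On and inside the curve the only eigenvalue is `μ`, exactly where the complementary pencil
  -- remains invertible.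
  have hK : ∀ z ∈ γ '' Icc a b ∪ enclosedRegion γ a b, z = μ ∨ z ∉ spectrum ℂ A := by
    rintro z (hz | hz)
    · exact Or.inr fun hzA => disjoint_left.1 hcurve hzA hz
    · by_cases hzA : z ∈ spectrum ℂ A
      · exact Or.inl (hregion.subset ⟨hzA, hz⟩)
      · exact Or.inr hzA
  have hrest : HasContourIntegral (fun z => f z • ((1 - characteristicProjection A μ) *
      (Matrix.complementaryPencil A μ z)⁻¹)) γ a b 0 := by
    refine hasContourIntegral_matrix fun i j => ?_
    refine h.hasContourIntegral_zero_of_analyticOnNhd hμ fun z hz => ?_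
    simp only [Matrix.smul_apply, smul_eq_mul, Matrix.mul_apply]
    exact (hf z hz).mul (Finset.analyticAt_fun_sum _ fun k _ => analyticAt_const.mul
      (Matrix.analyticAt_inv (Matrix.analyticAt_complementaryPencil A μ z)
        (Matrix.det_complementaryPencil_ne_zero A μ (hK z hz)) k j))
  have := hsum.add hrest
  rw [add_zero] at this
  simp only [Finset.smul_sum, smul_smul]
  refine this.congr fun z hz => ?_
  have hzA : z ∉ spectrum ℂ A := fun hzA => disjoint_left.1 hcurve hzA hz
  simp only [cauchyIntegrand]
  rw [← Matrix.inv_mul_one_sub_characteristicProjection A μ hzA]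
  simp only [mul_smul]
  rw [← Finset.smul_sum, ← Matrix.inv_mul_characteristicProjection A hμA hzA, ← smul_add,
    ← mul_add, add_sub_cancel, mul_one]

theorem mainTheorem3 {n : ℕ} (A : Matrix (Fin n) (Fin n) ℂ) (lam : ℂ)
    (γ : ℝ → ℂ) (a b : ℝ)
    (hJordan : IsRectifiableJordanCurve γ a b)
    (hOriented : IsPositivelyOriented γ a b)
    (hCurve : Disjoint (spectrum ℂ A) (γ '' Icc a b))
    (hRegion : spectrum ℂ A ∩ enclosedRegion γ a b = {lam})
    (f : ℂ → ℂ) (hf : AnalyticOnNhd ℂ f (γ '' Icc a b ∪ enclosedRegion γ a b)) :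
    ContourIntegrable (cauchyIntegrand f A) γ a b ∧
    ∃ F : Matrix (Fin n) (Fin n) ℂ,
      IsMatrixFunctionValue f (lam • 1 + nilpotentPart A lam) F ∧
      (2 * (Real.pi : ℂ) * Complex.I)⁻¹ • contourIntegral (cauchyIntegrand f A) γ a b =
        F * characteristicProjection A lam ∧
      F * characteristicProjection A lam =
        ∑ l ∈ Finset.range (A.charpoly.rootMultiplicity lam),
          (iteratedDeriv l f lam / (l.factorial : ℂ)) •
            (nilpotentPart A lam ^ l * characteristicProjection A lam) ∧
      HasSum (fun l : ℕ => (iteratedDeriv l f lam / (l.factorial : ℂ)) •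
          (nilpotentPart A lam ^ l * characteristicProjection A lam))
        (F * characteristicProjection A lam) := by
  obtain ⟨hlamA, hlam⟩ : lam ∈ spectrum ℂ A ∩ enclosedRegion γ a b := hRegion ▸ mem_singleton lam
  -- For `n = 0` the spectrum is empty and could not contain `lam`.
  have : Nontrivial (Matrix (Fin n) (Fin n) ℂ) := by
    by_contra hn
    have := not_nontrivial_iff_subsingleton.1 hn
    rw [spectrum.of_subsingleton] at hlamA
    exact hlamA
  have hN := Matrix.nilpotentPart_pow_rootMultiplicity A hlamA
  have hspec := Matrix.spectrum_smul_one_add_of_nilpotent lam hN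
  have hint := hJordan.hasContourIntegral_cauchyIntegrand hOriented hCurve hRegion hf
  have hFP : (∑ l ∈ Finset.range (A.charpoly.rootMultiplicity lam),
        (iteratedDeriv l f lam / (l.factorial : ℂ)) • nilpotentPart A lam ^ l) *
      characteristicProjection A lam =
      ∑ l ∈ Finset.range (A.charpoly.rootMultiplicity lam),
        (iteratedDeriv l f lam / (l.factorial : ℂ)) •
          (nilpotentPart A lam ^ l * characteristicProjection A lam) := by
    simp only [Finset.sum_mul, smul_mul_assoc]
  -- The value of `f(λ + N)` is the Taylor polynomial of `f` at λ evaluated at N, and the given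
  -- curve already serves as a contour for it.
  refine ⟨⟨_, hint⟩, ∑ l ∈ Finset.range (A.charpoly.rootMultiplicity lam),
    (iteratedDeriv l f lam / (l.factorial : ℂ)) • nilpotentPart A lam ^ l,
    ⟨⟨γ, a, b, hJordan, hOriented, hf, ?_⟩, ?_⟩, ?_, hFP, ?_⟩
  · rw [hspec]
    exact singleton_subset_iff.2 hlam
  -- Any other contour must enclose λ, the whole spectrum of λ + N, so the nilpotent formula returns
  -- the same polynomial.
  · intro γ' a' b' h'
    have hlam' : lam ∈ enclosedRegion γ' a' b' := h'.spectrum_subset (hspec ▸ mem_singleton lam)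
    have hint' := h'.jordan.hasContourIntegral_cauchyIntegrand_of_nilpotent h'.oriented hlam'
      h'.analytic hN
    refine ⟨⟨_, hint'⟩, ?_⟩
    rw [hint'.contourIntegral_eq h'.jordan.lt.le, inv_smul_smul₀ Complex.two_pi_I_ne_zero]
  · rw [hint.contourIntegral_eq hJordan.lt.le, inv_smul_smul₀ Complex.two_pi_I_ne_zero, hFP]
  · rw [hFP]
    refine hasSum_sum_of_ne_finset_zero fun l hl => ?_
    rw [Finset.mem_range, not_lt] at hl
    rw [pow_eq_zero_of_le hl hN, zero_mul, smul_zero]
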